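/- Let $M\ge 1$ and, for $j\in\{1,2\}$, let $N_j>M$ (oversampled regime) and let $Y_j$ be an $M\times N_j$ real or complex data matrix with sample covariance matrix $\hat R_j=N_j^{-1}Y_jY_j^H$. Assume that $\hat R_j$ has distinct positive eigenvalues $0<\hat\lambda^{(j)}_1<\dots<\hat\lambda^{(j)}_M$, with orthonormal eigenvectors $\hat e^{(j)}_1,\dots,\hat e^{(j)}_M$. Then the equation $$1=\frac1{N_j}\sum_{k=1}^M\frac{\hat\lambda^{(j)}_k}{\hat\lambda^{(j)}_k-\mu}$$ has exactly $M$ real solutions; denote them by $\hat\mu^{(j)}_1<\dots<\hat\mu^{(j)}_M$. Put $\hat Q_j(z)=(\hat R_j-zI_M)^{-1}$, $\hat\omega_j(z)=z\big/\big(1-N_j^{-1}\mathrm{tr}[\hat R_j\hat Q_j(z)]\big)$, and, for a function $f$, $\hat h_j[f](z)=f(\hat\omega_j(z))\,\frac{z\,\hat\omega_j'(z)}{\hat\omega_j(z)}$; $\log$ is the principal branch. Call a closed piecewise $C^1$ curve $C$ in $\mathbb C\setminus(-\infty,0]$ admissible for $j$ if it runs once, clockwise, around each of the intervals $[\hat\mu^{(j)}_k,\hat\lambda^{(j)}_k]$,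 $k=1,\dots,M$ (it misses the interval and has winding number $-1$ about each of its points). Let $\mathrm{Li}_2(x)=-\int_0^x y^{-1}\log(1-y)\,dy$ for $x\le 1$, and $$\Phi_2(x)=\begin{cases}\mathrm{Li}_2(x), & x<1,\\ \frac{\pi^2}{3}-\frac12\log^2x-\mathrm{Li}_2(x^{-1}), & x\ge1.\end{cases}$$ (i) For $j\in\{1,2\}$ and every contour $C$ admissible for $j$, the integral $$\frac1{2\pi\mathrm i}\oint_{C}\log^2(\hat\omega_j(z))\,\frac{z\,\hat\omega_j'(z)}{\hat\omega_j(z)}\,\frac1M\mathrm{tr}[\hat Q_j(z)]\,dz$$ equals (superscripts $(j)$ omitted on the right) $$\begin{aligned}\alpha^{(j)}={}&\Big(\frac{N_j}{M}-1\Big)\sum_{r=1}^M\Big((1+\log\hat\mu_r)^2-(1+\log\hat\lambda_r)^2\Big)+\frac1M\sum_{k=1}^M(1+\log\hat\lambda_k)^2-\Big(\frac{N_j}{M}-1\Big)\log^2\Big(1-\frac M{N_j}\Big)+1\\&+\frac2M\sum_{k=1}^M\sum_{r=1}^M\Big[\Phi_2\Big(\frac{\hat\mu_r}{\hat\lambda_k}\Big)-\Phi_2\Big(\frac{\hat\lambda_r}{\hat\lambda_k}\Big)\Big]\\&+\frac2M\sum_{k=1}^M\Big(\sum_{r\ne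 k}\log\frac{\hat\lambda_r}{\hat\lambda_k}\log\frac{\hat\lambda_k}{|\hat\lambda_k-\hat\lambda_r|}-\sum_{r=1}^M\log\frac{\hat\mu_r}{\hat\lambda_k}\log\frac{\hat\lambda_k}{|\hat\lambda_k-\hat\mu_r|}\Big).\end{aligned}$$ (ii) For $j\in\{1,2\}$ and every contour $C$ admissible for $j$, $$\frac1{2\pi\mathrm i}\oint_{C}\log(\hat\omega_j(z))\,\frac{z\,\hat\omega_j'(z)}{\hat\omega_j(z)}\,\hat Q_j(z)\,dz=\sum_{k=1}^M\beta^{(j)}_k\,\hat e^{(j)}_k(\hat e^{(j)}_k)^H,$$ where (superscripts $(j)$ again omitted on the right) $$\beta^{(j)}_k=\Big(1+\sum_{m\ne k}\frac{\hat\lambda_k}{\hat\lambda_m-\hat\lambda_k}-\sum_{m=1}^M\frac{\hat\mu_k}{\hat\lambda_m-\hat\mu_k}\Big)\log\hat\lambda_k+\sum_{r\ne k}\frac{\hat\lambda_r}{\hat\lambda_r-\hat\lambda_k}\log\hat\lambda_r-\sum_{r=1}^M\frac{\hat\mu_r}{\hat\mu_r-\hat\lambda_k}\log\hat\mu_r+1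 .$$ (iii) Consider the estimator of the log-Euclidean distance $\frac1M\mathrm{tr}[(\log R_1-\log R_2)^2]$ between two covariance matrices defined by $$\hat d^{LE}_M(1,2)=\sum_{l=1}^{3}\frac{-1}{4\pi^2}\oint_{C_1^{(l)}}\oint_{C_2^{(l)}}\hat h_1[f_1^{(l)}](z_1)\,\hat h_2[f_2^{(l)}](z_2)\,\frac1M\mathrm{tr}\big[\hat Q_1(z_1)\hat Q_2(z_2)\big]\,dz_2\,dz_1,$$ where $(f_1^{(l)},f_2^{(l)})_{l=1,2,3}$ are the pairs $(\log^2,1)$, $(1,\log^2)$, $(-2\log,\log)$, and each contour $C_j^{(l)}$ is admissible for $j$. Then, for every choice of such contours, $$\hat d^{LE}_M(1,2)=\alpha^{(1)}+\alpha^{(2)}-\frac2M\sum_{k=1}^M\sum_{m=1}^M\beta_k^{(1)}\beta_m^{(2)}\,\big|(\hat e_k^{(1)})^H\hat e_m^{(2)}\big|^2 .$$ -/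

import Mathlib

open Matrix

namespace LogEuclid

noncomputable section

/-- A contour: a closed piecewise continuously differentiable curve `[0, 1] → ℂ`. -/
structure Contour where
  toFun : ℝ → ℂ
  closed : toFun 0 = toFun 1
  piecewise : ∃ (n : ℕ) (s : Fin (n + 1) → ℝ), StrictMono s ∧ s 0 = 0 ∧ s (Fin.last n) = 1 ∧
    ∀ i : Fin n, ContDiffOn ℝ 1 toFun (Set.Icc (s i.castSucc) (s i.succ))

/-- The contour integral `∮_γ f(z) dz`. -/
def Contour.integral (γ : Contour) (f : ℂ → ℂ) : ℂ :=
  ∫ t in (0 : ℝ)..1, f (γ.toFun t) * deriv γ.toFun t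

/-- The curve runs once, clockwise, around the point `w`: it misses `w` and has winding number
`-1` about `w`.  For a clockwise oriented simple closed curve these are the points inside it. -/
def Contour.Encloses (γ : Contour) (w : ℂ) : Prop :=
  (∀ t ∈ Set.Icc (0 : ℝ) 1, γ.toFun t ≠ w) ∧
    (2 * (Real.pi : ℂ) * Complex.I)⁻¹ * γ.integral (fun z => 1 / (z - w)) = -1

/-- The sample covariance matrix `N⁻¹ Y Yᴴ` of the observations in the columns of `Y`. -/
def sampleCov {M N : ℕ} (Y : Matrix (Fin M) (Fin N) ℂ) : Matrix (Fin M) (Fin M) ℂ :=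
  (1 / (N : ℂ)) • (Y * Yᴴ)

/-- `lam` lists the eigenvalues of `A`, and `e` is a corresponding orthonormal family of
eigenvectors. -/
structure IsEigendecomposition {M : ℕ} (A : Matrix (Fin M) (Fin M) ℂ) (lam : Fin M → ℝ)
    (e : Fin M → Fin M → ℂ) : Prop where
  eigen : ∀ k, A *ᵥ e k = (lam k : ℂ) • e k
  orthonormal : ∀ k m, star (e k) ⬝ᵥ e m = if k = m then 1 else 0

/-- `mu` lists, in increasing order, the solutions `x` of `1 = N⁻¹ ∑ₖ λₖ / (λₖ - x)`. -/
def IsRootList {M : ℕ} (N : ℕ) (lam mu : Fin M → ℝ) : Prop :=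
  StrictMono mu ∧
    Set.range mu = {x : ℝ | (∀ k, x ≠ lam k) ∧ 1 = (1 / (N : ℝ)) * ∑ k, lam k / (lam k - x)}

/-- The contour does not meet the half-line `(-∞, 0]` and encloses the intervals `[μₖ, λₖ]`. -/
def Contour.IsAdmissible {M : ℕ} (γ : Contour) (lam mu : Fin M → ℝ) : Prop :=
  (∀ t ∈ Set.Icc (0 : ℝ) 1, γ.toFun t ∈ Complex.slitPlane) ∧
    ∀ k, ∀ x ∈ Set.Icc (mu k) (lam k), γ.Encloses (x : ℂ)

section Resolvent

variable {M : ℕ} (N : ℕ) (R : Matrix (Fin M) (Fin M) ℂ)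

/-- The resolvent `(R - z I)⁻¹`. -/
def sampleResolvent (z : ℂ) : Matrix (Fin M) (Fin M) ℂ := (R - z • (1 : Matrix (Fin M) (Fin M) ℂ))⁻¹

/-- `ω̂(z) = z / (1 - N⁻¹ tr[R Q(z)])`. -/
def omegaHat (z : ℂ) : ℂ := z / (1 - (1 / (N : ℂ)) * (R * sampleResolvent R z).trace)

/-- `ĥ(z) = f(ω̂(z)) (z / ω̂(z)) ω̂'(z)`. -/
def hHat (f : ℂ → ℂ) (z : ℂ) : ℂ :=
  f (omegaHat N R z) * (z / omegaHat N R z) * deriv (omegaHat N R) z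

/-- The matrix `(2πi)⁻¹ ∮ ĥ(z) Q(z) dz`, with the integral taken entry by entry. -/
def matrixEstimator (f : ℂ → ℂ) (γ : Contour) : Matrix (Fin M) (Fin M) ℂ :=
  Matrix.of fun i k => (2 * (Real.pi : ℂ) * Complex.I)⁻¹ *
    γ.integral (fun z => hHat N R f z * sampleResolvent R z i k)

/-- The integral `α = (2πi)⁻¹ ∮ log²(ω̂(z)) (z ω̂'(z) / ω̂(z)) M⁻¹ tr[Q(z)] dz`. -/
def alphaIntegral (γ : Contour) : ℂ :=
  (2 * (Real.pi : ℂ) * Complex.I)⁻¹ * γ.integral (fun z =>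
    Complex.log (omegaHat N R z) ^ 2 * (z * deriv (omegaHat N R) z / omegaHat N R z) *
      ((1 / (M : ℂ)) * (sampleResolvent R z).trace))

end Resolvent

/-- The estimator, built from two sample covariance matrices, of
`∑ₗ M⁻¹ tr[f₁⁽ˡ⁾(R₁) f₂⁽ˡ⁾(R₂)]`, as a sum of double contour integrals. -/
def distanceEstimator {M L : ℕ} (N : Fin 2 → ℕ) (R : Fin 2 → Matrix (Fin M) (Fin M) ℂ)
    (f : Fin 2 → Fin L → ℂ → ℂ) (C : Fin 2 → Fin L → Contour) : ℂ :=
  ∑ l, (-1 / (4 * (Real.pi : ℂ) ^ 2)) *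
    (C 0 l).integral (fun z₁ => (C 1 l).integral (fun z₂ =>
      hHat (N 0) (R 0) (f 0 l) z₁ * hHat (N 1) (R 1) (f 1 l) z₂ *
        ((1 / (M : ℂ)) * (sampleResolvent (R 0) z₁ * sampleResolvent (R 1) z₂).trace)))

/-- The functions of the log-Euclidean distance, from
`(log ω₁ - log ω₂)² = log² ω₁ · 1 + 1 · log² ω₂ + (-2 log ω₁) · log ω₂`. -/
def logEuclidFun : Fin 2 → Fin 3 → ℂ → ℂ :=
  ![![fun w => Complex.log w ^ 2, fun _ => 1, fun w => -2 * Complex.log w],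
    ![fun _ => 1, fun w => Complex.log w ^ 2, fun w => Complex.log w]]

/-- The dilogarithm `Li₂(x) = -∫₀ˣ y⁻¹ log(1 - y) dy`, for real `x ≤ 1`. -/
def Li2 (x : ℝ) : ℝ := -∫ y in (0 : ℝ)..x, y⁻¹ * Real.log (1 - y)

/-- The variant `Φ₂` of the dilogarithm. -/
def Phi2 (x : ℝ) : ℝ :=
  if x < 1 then Li2 x else Real.pi ^ 2 / 3 - (1 / 2) * Real.log x ^ 2 - Li2 x⁻¹

/-- The closed form of `α`. -/
def alphaClosed {M : ℕ} (N : ℕ) (lam mu : Fin M → ℝ) : ℝ :=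
  ((N : ℝ) / M - 1) * ∑ r, ((1 + Real.log (mu r)) ^ 2 - (1 + Real.log (lam r)) ^ 2)
  + (1 / (M : ℝ)) * ∑ k, (1 + Real.log (lam k)) ^ 2
  - ((N : ℝ) / M - 1) * Real.log (1 - (M : ℝ) / N) ^ 2
  + 1
  + (2 / (M : ℝ)) * ∑ k, ∑ r, (Phi2 (mu r / lam k) - Phi2 (lam r / lam k))
  + (2 / (M : ℝ)) * ∑ k,
      ((∑ r with r ≠ k, Real.log (lam r / lam k) * Real.log (lam k / |lam k - lam r|))
        - ∑ r, Real.log (mu r / lam k) * Real.log (lam k / |lam k - mu r|))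

/-- The coefficients `βₖ`. -/
def betaCoeff {M : ℕ} (lam mu : Fin M → ℝ) (k : Fin M) : ℝ :=
  (1 + (∑ m with m ≠ k, lam k / (lam m - lam k)) - ∑ m, mu k / (lam m - mu k)) * Real.log (lam k)
  + ((∑ r with r ≠ k, lam r / (lam r - lam k) * Real.log (lam r))
      - ∑ r, mu r / (mu r - lam k) * Real.log (mu r))
  + 1

end

end LogEuclid

open LogEuclid

/-! The function `secular` has exactly one zero μ_k in each gap below λ_k (the first gap starting at
0), so 1 - N⁻¹ tr[R Q(z)] = ∏ (z - μ_k)/(z - λ_k) and ω̂(z) = z ∏ (z - λ_k)/(z - μ_k). Hence L(z) =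
log z + S(z), with S the sum of log((z - λ_k)/(z - μ_k)), is a logarithm of ω̂, holomorphic off the
half-line and the intervals [μ_k, λ_k]. The intervals are disjoint and t ↦ arg(z - t) is monotone,
so |Im L| < π and L is the principal logarithm (`log_omegaHat`).

No local analysis at the branch points is needed. Since S(z) = -∑ ∫ dx/(z - x) over the intervals,
Fubini turns the residue of S·g into minus the integral over x of the residue of g(z)/(z - x), a
Cauchy kernel at an enclosed point (`residue_cutLog_mul`). A product of two or three factors (z -
p)⁻¹ with every p enclosed has residue sum 0, and this kills S/(z - w), S/((z - v)(z - w)) and S²/(z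
- w). What survives is S·log z/(z - w), which gives integrals of divided differences of log, that
is, dilogarithms, and the terms with 1/z, whose pole lies outside the contour.

For log², the partial fractions of 1/ω̂ = exp(-L) express ∑ 1/(z - λ_k) through exp(-L) and 1/z.
Modulo an exact derivative, an integration by parts replaces L²·zL'·∑ 1/(z - λ_k) by ((1 + L)² +
1)((N - M)/z + ∑ 1/(z - λ_k)), to which the above rules apply (`sum_coeffIntegral_sq_eq`).

For log, zL'/(z - λ_k) is a combination of (z - λ_k)⁻¹ and of products of two Cauchy kernels, so S
drops out and only divided differences of log remain. Two identities between the λ's and the μ's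
bring the result to the form β_k (`betaCoeff_eq`). For the constant function 1 the same expansion
gives 1.

Finally, in the eigenbases the double integral separates into products of single integrals, weighted
by the squared moduli |e_kᴴ e'_m|². These form a doubly stochastic matrix, so a factor 1 disappears
and the pairs containing log² yield α⁽¹⁾ and α⁽²⁾. -/

namespace LogEuclid

noncomputable section

open Set MeasureTheory intervalIntegral Filter Topology

/-! ### Contour integrals -/

namespace Contour

variable (γ : Contour)

/-- The image of a contour. -/
def image : Set ℂ := γ.toFun '' Icc 0 1

lemma continuousOn_toFun : ContinuousOn γ.toFun (Icc 0 1) := by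
  obtain ⟨n, s, hs, h0, h1, hd⟩ := γ.piecewise
  have key : ∀ m : Fin (n + 1), ContinuousOn γ.toFun (Icc 0 (s m)) := by
    intro m
    induction m using Fin.induction with
    | zero => simp [h0]
    | succ i ih =>
      have h0i : 0 ≤ s i.castSucc := h0 ▸ hs.monotone (Fin.zero_le _)
      rw [← Icc_union_Icc_eq_Icc h0i (hs Fin.castSucc_lt_succ).le]
      exact ih.union_of_isClosed (hd i).continuousOn isClosed_Icc isClosed_Icc
  simpa [h1] using key (Fin.last n)

lemma intervalIntegrable_deriv : IntervalIntegrable (deriv γ.toFun) volume 0 1 := by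
  obtain ⟨n, s, hs, h0, h1, hd⟩ := γ.piecewise
  have key : ∀ m : Fin (n + 1), IntervalIntegrable (deriv γ.toFun) volume 0 (s m) := by
    intro m
    induction m using Fin.induction with
    | zero => simp [h0]
    | succ i ih =>
      refine ih.trans ?_
      have hlt : s i.castSucc < s i.succ := hs Fin.castSucc_lt_succ
      have hc : ContinuousOn (derivWithin γ.toFun (Icc (s i.castSucc) (s i.succ)))
          (Icc (s i.castSucc) (s i.succ)) :=
        (hd i).continuousOn_derivWithin (uniqueDiffOn_Icc hlt) le_rfl
      have hi : IntervalIntegrable (derivWithin γ.toFun (Icc (s i.castSucc) (s i.succ))) volume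
          (s i.castSucc) (s i.succ) := by
        apply ContinuousOn.intervalIntegrable
        rwa [uIcc_of_le hlt.le]
      -- Only the open piece is compared: at a breakpoint `deriv` may take its default value, but
      -- that is a null set.
      rw [intervalIntegrable_iff_integrableOn_Ioo_of_le hlt.le] at hi ⊢
      refine hi.congr_fun (fun x hx => ?_) measurableSet_Ioo
      exact derivWithin_of_mem_nhds (Icc_mem_nhds hx.1 hx.2)
  simpa [h1] using key (Fin.last n)

lemma exists_countable_differentiableAt :
    ∃ s : Set ℝ, s.Countable ∧ ∀ t ∈ Ioo (0 : ℝ) 1 \ s, DifferentiableAt ℝ γ.toFun t := by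
  obtain ⟨n, s, hs, h0, h1, hd⟩ := γ.piecewise
  have cover : ∀ m : Fin (n + 1), ∀ t ∈ Icc 0 (s m), t ∉ range s →
      ∃ i : Fin n, t ∈ Ioo (s i.castSucc) (s i.succ) := by
    intro m
    induction m using Fin.induction with
    | zero =>
      intro t ht hts
      exact absurd ⟨0, by rw [h0] at ht ⊢; exact le_antisymm ht.1 ht.2⟩ hts
    | succ i ih =>
      intro t ht hts
      rcases le_or_gt t (s i.castSucc) with h | h
      · exact ih t ⟨ht.1, h⟩ hts
      · exact ⟨i, h, lt_of_le_of_ne ht.2 fun h' => hts ⟨_, h'.symm⟩⟩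
  refine ⟨range s, (finite_range s).countable, fun t ht => ?_⟩
  obtain ⟨i, hi⟩ := cover (Fin.last n) t ⟨ht.1.1.le, h1 ▸ ht.1.2.le⟩ ht.2
  exact ((hd i).contDiffAt (Icc_mem_nhds hi.1 hi.2)).differentiableAt one_ne_zero

lemma continuousOn_comp {f : ℂ → ℂ} (hf : ContinuousOn f γ.image) :
    ContinuousOn (fun t => f (γ.toFun t)) (uIcc 0 1) := by
  rw [uIcc_of_le zero_le_one]
  exact hf.comp γ.continuousOn_toFun (mapsTo_image _ _)

lemma intervalIntegrable {f : ℂ → ℂ} (hf : ContinuousOn f γ.image) :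
    IntervalIntegrable (fun t => f (γ.toFun t) * deriv γ.toFun t) volume 0 1 :=
  γ.intervalIntegrable_deriv.continuousOn_mul (γ.continuousOn_comp hf)

lemma integral_congr {f g : ℂ → ℂ} (h : EqOn f g γ.image) : γ.integral f = γ.integral g := by
  refine intervalIntegral.integral_congr fun t ht => ?_
  rw [uIcc_of_le zero_le_one] at ht
  simp only [h (mem_image_of_mem _ ht)]

lemma integral_add {f g : ℂ → ℂ} (hf : ContinuousOn f γ.image) (hg : ContinuousOn g γ.image) :
    γ.integral (fun z => f z + g z) = γ.integral f + γ.integral g := by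
  simp only [integral, add_mul]
  exact intervalIntegral.integral_add (γ.intervalIntegrable hf) (γ.intervalIntegrable hg)

lemma integral_const_mul (c : ℂ) (f : ℂ → ℂ) :
    γ.integral (fun z => c * f z) = c * γ.integral f := by
  simp only [integral, mul_assoc, intervalIntegral.integral_const_mul]

/-- The fundamental theorem of calculus for closed contours. -/
lemma integral_eq_zero_of_hasDerivAt {F f : ℂ → ℂ} (hF : ∀ z ∈ γ.image, HasDerivAt F (f z) z)
    (hf : ContinuousOn f γ.image) : γ.integral f = 0 := by
  obtain ⟨s, hs, hd⟩ := γ.exists_countable_differentiableAt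
  have hFc : ContinuousOn F γ.image := fun z hz => (hF z hz).continuousAt.continuousWithinAt
  have := MeasureTheory.integral_eq_of_hasDerivAt_off_countable_of_le
    (fun t => F (γ.toFun t)) (fun t => f (γ.toFun t) * deriv γ.toFun t) zero_le_one hs
    (hFc.comp γ.continuousOn_toFun (mapsTo_image _ _))
    (fun t ht => (hF _ (mem_image_of_mem _ (Ioo_subset_Icc_self ht.1))).comp t
      (hd t ht).hasDerivAt) (γ.intervalIntegrable hf)
  rw [integral, this, γ.closed, sub_self]

/-- Fubini's theorem for a contour integral of an integral over an interval. -/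
lemma integral_intervalIntegral {a b : ℝ} (hab : a ≤ b) {k : ℝ → ℂ → ℂ}
    (hk : ContinuousOn k.uncurry (Icc a b ×ˢ γ.image)) :
    γ.integral (fun z => ∫ x in a..b, k x z) = ∫ x in a..b, γ.integral (k x) := by
  have h1 : ∀ t, (∫ x in a..b, k x (γ.toFun t)) * deriv γ.toFun t =
      ∫ x in a..b, k x (γ.toFun t) * deriv γ.toFun t := fun t =>
    (intervalIntegral.integral_mul_const _ _).symm
  simp only [integral, h1]
  symm
  apply MeasureTheory.intervalIntegral_intervalIntegral_swap
  have hcont : ContinuousOn (fun p : ℝ × ℝ => k p.1 (γ.toFun p.2)) (Icc a b ×ˢ Icc 0 1) :=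
    hk.comp (continuousOn_fst.prodMk (γ.continuousOn_toFun.comp continuousOn_snd fun p hp => hp.2))
      fun p hp => ⟨hp.1, mem_image_of_mem _ hp.2⟩
  -- The kernel is bounded on the compact rectangle, so the integrand is a bounded factor times the
  -- integrable function `deriv γ.toFun`.
  have hcompact : IsCompact (Icc a b ×ˢ Icc (0 : ℝ) 1) := isCompact_Icc.prod isCompact_Icc
  obtain ⟨C, hC⟩ := hcompact.exists_bound_of_continuousOn hcont
  have hsub : uIoc a b ×ˢ uIoc (0 : ℝ) 1 ⊆ Icc a b ×ˢ Icc 0 1 := by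
    rw [uIoc_of_le hab, uIoc_of_le zero_le_one]
    exact prod_mono Ioc_subset_Icc_self Ioc_subset_Icc_self
  have hmeas : MeasurableSet (uIoc a b ×ˢ uIoc (0 : ℝ) 1) :=
    measurableSet_uIoc.prod measurableSet_uIoc
  have hdint : IntegrableOn (fun p : ℝ × ℝ => deriv γ.toFun p.2) (uIoc a b ×ˢ uIoc (0 : ℝ) 1) := by
    rw [IntegrableOn, Measure.volume_eq_prod, ← Measure.prod_restrict]
    have hd := γ.intervalIntegrable_deriv.def'
    have : IsFiniteMeasure (volume.restrict (uIoc a b)) := ⟨by simp [uIoc_of_le hab]⟩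
    exact Integrable.comp_snd hd _
  refine Integrable.bdd_mul (c := C) hdint ?_ ?_
  · exact (hcont.mono hsub).aestronglyMeasurable hmeas
  · exact (ae_restrict_mem hmeas).mono fun p hp => hC p (hsub hp)

end Contour

/-- A holomorphic function on the slit plane has a primitive. -/
lemma exists_primitive_slitPlane {g : ℂ → ℂ} (hg : DifferentiableOn ℂ g Complex.slitPlane) :
    ∃ G : ℂ → ℂ, ∀ z ∈ Complex.slitPlane, HasDerivAt G (g z) z := by
  -- The slit plane is not convex, but `exp` maps this convex strip onto it with inverse `log`. The
  -- function is pulled back by `exp`, integrated on the strip, and the primitive composed with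
  -- `log`.
  let S : Set ℂ := Complex.im ⁻¹' Ioo (-Real.pi) Real.pi
  have hSo : IsOpen S := isOpen_Ioo.preimage Complex.continuous_im
  have hSc : Convex ℝ S := (convex_Ioo _ _).linear_preimage Complex.imLm
  have hexp : MapsTo Complex.exp S Complex.slitPlane := by
    intro w hw
    rw [Complex.mem_slitPlane_iff_arg]
    refine ⟨?_, Complex.exp_ne_zero w⟩
    rw [← Complex.log_im, Complex.log_exp hw.1 hw.2.le]
    exact hw.2.ne
  obtain ⟨G, hG⟩ := hSc.exists_forall_hasDerivWithinAt
    (f := fun w => g (Complex.exp w) * Complex.exp w)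
    ((hg.comp Complex.differentiable_exp.differentiableOn hexp).mul
      Complex.differentiable_exp.differentiableOn)
  refine ⟨fun z => G (Complex.log z), fun z hz => ?_⟩
  have hlog : Complex.log z ∈ S := by
    rw [Complex.mem_slitPlane_iff_arg] at hz
    refine ⟨?_, ?_⟩
    · rw [Complex.log_im]; exact Complex.neg_pi_lt_arg z
    · rw [Complex.log_im]; exact lt_of_le_of_ne (Complex.arg_le_pi z) hz.1
  have h := ((hG _ hlog).hasDerivAt (hSo.mem_nhds hlog)).comp z (Complex.hasDerivAt_log hz)
  have hz0 : z ≠ 0 := Complex.slitPlane_ne_zero hz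
  simpa [Function.comp_def, Complex.exp_log hz0, mul_assoc, mul_inv_cancel₀ hz0] using h

/-! ### Sums of residues -/

namespace Contour

variable (γ : Contour)

/-- The clockwise normalized contour integral `-(2πi)⁻¹ ∮ f(z) dz`, the sum of the residues of `f`
at the enclosed singularities. -/
def residue (f : ℂ → ℂ) : ℂ := -((2 * (Real.pi : ℂ) * Complex.I)⁻¹ * γ.integral f)

variable {γ}

lemma residue_congr {f g : ℂ → ℂ} (h : EqOn f g γ.image) : γ.residue f = γ.residue g := by
  rw [residue, residue, γ.integral_congr h]

lemma residue_add {f g : ℂ → ℂ} (hf : ContinuousOn f γ.image) (hg : ContinuousOn g γ.image) :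
    γ.residue (fun z => f z + g z) = γ.residue f + γ.residue g := by
  rw [residue, γ.integral_add hf hg, residue, residue]; ring

lemma residue_const_mul (c : ℂ) (f : ℂ → ℂ) :
    γ.residue (fun z => c * f z) = c * γ.residue f := by
  rw [residue, integral_const_mul, residue]; ring

lemma residue_neg (f : ℂ → ℂ) : γ.residue (fun z => -f z) = -γ.residue f := by
  simpa using residue_const_mul (γ := γ) (-1) f

lemma residue_sub {f g : ℂ → ℂ} (hf : ContinuousOn f γ.image) (hg : ContinuousOn g γ.image) :
    γ.residue (fun z => f z - g z) = γ.residue f - γ.residue g := by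
  simp only [sub_eq_add_neg]
  rw [residue_add hf hg.fun_neg, residue_neg]

lemma residue_zero : γ.residue (fun _ => 0) = 0 := by simp [residue, integral]

lemma residue_sum {ι : Type*} (s : Finset ι) {f : ι → ℂ → ℂ}
    (hf : ∀ i ∈ s, ContinuousOn (f i) γ.image) :
    γ.residue (fun z => ∑ i ∈ s, f i z) = ∑ i ∈ s, γ.residue (f i) := by
  classical
  induction s using Finset.induction_on with
  | empty => simpa using residue_zero
  | insert a s ha ih =>
    simp only [Finset.sum_insert ha]
    have hs : ∀ i ∈ s, ContinuousOn (f i) γ.image := fun i hi => hf i (Finset.mem_insert_of_mem hi)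
    rw [residue_add (hf a (Finset.mem_insert_self _ _)) (continuousOn_finsetSum _ hs), ih hs]

lemma residue_eq_zero_of_hasDerivAt {F f : ℂ → ℂ} (hF : ∀ z ∈ γ.image, HasDerivAt F (f z) z)
    (hf : ContinuousOn f γ.image) : γ.residue f = 0 := by
  rw [residue, γ.integral_eq_zero_of_hasDerivAt hF hf]; simp

lemma residue_intervalIntegral {a b : ℝ} (hab : a ≤ b) {k : ℝ → ℂ → ℂ}
    (hk : ContinuousOn k.uncurry (Icc a b ×ˢ γ.image)) :
    γ.residue (fun z => ∫ x in a..b, k x z) = ∫ x in a..b, γ.residue (k x) := by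
  simp only [residue, γ.integral_intervalIntegral hab hk, intervalIntegral.integral_neg,
    intervalIntegral.integral_const_mul]

lemma residue_eq_zero_of_differentiableOn (hγ : γ.image ⊆ Complex.slitPlane) {g : ℂ → ℂ}
    (hg : DifferentiableOn ℂ g Complex.slitPlane) : γ.residue g = 0 := by
  obtain ⟨G, hG⟩ := exists_primitive_slitPlane hg
  exact residue_eq_zero_of_hasDerivAt (fun z hz => hG z (hγ hz)) (hg.continuousOn.mono hγ)

variable {x y w : ℂ}

lemma Encloses.notMem_image (hx : γ.Encloses x) : x ∉ γ.image := by
  rintro ⟨t, ht, h⟩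
  exact hx.1 t ht h

lemma Encloses.sub_ne_zero (hx : γ.Encloses x) : ∀ z ∈ γ.image, z - x ≠ 0 := by
  intro z hz h
  rw [_root_.sub_eq_zero] at h
  exact hx.notMem_image (h ▸ hz)

lemma Encloses.continuousOn_inv_sub (hx : γ.Encloses x) :
    ContinuousOn (fun z => (z - x)⁻¹) γ.image :=
  (continuousOn_id.sub continuousOn_const).inv₀ hx.sub_ne_zero

lemma Encloses.residue_inv_sub (hx : γ.Encloses x) : γ.residue (fun z => (z - x)⁻¹) = 1 := by
  have := hx.2
  simp only [one_div] at this
  rw [residue, this, neg_neg]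

/-- Cauchy's integral formula. -/
lemma Encloses.residue_mul_inv_sub (hx : γ.Encloses x) (hγ : γ.image ⊆ Complex.slitPlane)
    (hxs : x ∈ Complex.slitPlane) {g : ℂ → ℂ} (hg : DifferentiableOn ℂ g Complex.slitPlane) :
    γ.residue (fun z => g z * (z - x)⁻¹) = g x := by
  -- The quotient (g(z) - g(x))/(z - x), with its removable singularity filled in, is holomorphic on
  -- the slit plane and integrates to zero.
  have hds : DifferentiableOn ℂ (dslope g x) Complex.slitPlane :=
    (Complex.differentiableOn_dslope (Complex.isOpen_slitPlane.mem_nhds hxs)).2 hg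
  have h1 : EqOn (fun z => g z * (z - x)⁻¹) (fun z => dslope g x z + g x * (z - x)⁻¹) γ.image := by
    intro z hz
    have hzx := hx.sub_ne_zero z hz
    simp only [dslope_of_ne g (_root_.sub_ne_zero.1 hzx), slope_def_field]
    field_simp
    ring
  rw [residue_congr h1, residue_add (hds.continuousOn.mono hγ)
    (continuousOn_const.fun_mul hx.continuousOn_inv_sub), residue_const_mul, hx.residue_inv_sub,
    residue_eq_zero_of_differentiableOn hγ hds]
  simp

/-- For distinct poles the two residues are opposite, as partial fractions show; for a double pole
there is a single-valued primitive. This vanishing removes most terms involving the cut logarithms.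
-/
lemma Encloses.residue_inv_sub_mul_inv_sub (hx : γ.Encloses x) (hy : γ.Encloses y) :
    γ.residue (fun z => (z - x)⁻¹ * (z - y)⁻¹) = 0 := by
  by_cases hxy : x = y
  · subst hxy
    refine residue_eq_zero_of_hasDerivAt (F := fun z => -(z - x)⁻¹) (fun z hz => ?_)
      (hx.continuousOn_inv_sub.fun_mul hx.continuousOn_inv_sub)
    have h := (((hasDerivAt_id z).sub_const x).inv (hx.sub_ne_zero z hz)).neg
    refine h.congr_deriv ?_
    have := hx.sub_ne_zero z hz
    simp only [id]
    field_simp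
  · have hne : x - y ≠ 0 := _root_.sub_ne_zero.2 hxy
    have h1 : EqOn (fun z => (z - x)⁻¹ * (z - y)⁻¹)
        (fun z => (x - y)⁻¹ * ((z - x)⁻¹ - (z - y)⁻¹)) γ.image := by
      intro z hz
      have h1 := hx.sub_ne_zero z hz
      have h2 := hy.sub_ne_zero z hz
      simp only
      field_simp
      ring
    rw [residue_congr h1, residue_const_mul,
      residue_sub hx.continuousOn_inv_sub hy.continuousOn_inv_sub, hx.residue_inv_sub,
      hy.residue_inv_sub]
    simp

/-- Cauchy's formula applied to the divided difference of g. Using `dslope` covers x = y too, where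
the value is g'(x), so simple and double poles need no separate treatment. -/
lemma Encloses.residue_mul_inv_sub_mul_inv_sub (hx : γ.Encloses x) (hy : γ.Encloses y)
    (hγ : γ.image ⊆ Complex.slitPlane) (hxs : x ∈ Complex.slitPlane)
    (hys : y ∈ Complex.slitPlane) {g : ℂ → ℂ} (hg : DifferentiableOn ℂ g Complex.slitPlane) :
    γ.residue (fun z => g z * (z - x)⁻¹ * (z - y)⁻¹) = dslope g x y := by
  have hds : DifferentiableOn ℂ (dslope g x) Complex.slitPlane :=
    (Complex.differentiableOn_dslope (Complex.isOpen_slitPlane.mem_nhds hxs)).2 hg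
  have h1 : EqOn (fun z => g z * (z - x)⁻¹ * (z - y)⁻¹)
      (fun z => dslope g x z * (z - y)⁻¹ + g x * ((z - x)⁻¹ * (z - y)⁻¹)) γ.image := by
    intro z hz
    have hzx := hx.sub_ne_zero z hz
    have hzy := hy.sub_ne_zero z hz
    simp only [dslope_of_ne g (_root_.sub_ne_zero.1 hzx), slope_def_field]
    field_simp
    ring
  rw [residue_congr h1, residue_add ((hds.continuousOn.mono hγ).fun_mul hy.continuousOn_inv_sub)
    (continuousOn_const.fun_mul (hx.continuousOn_inv_sub.fun_mul hy.continuousOn_inv_sub)),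
    residue_const_mul, hx.residue_inv_sub_mul_inv_sub hy, hy.residue_mul_inv_sub hγ hys hds]
  simp

/-- If two poles differ, a partial fraction step reduces to products of two kernels; a triple pole
has a primitive. -/
lemma Encloses.residue_inv_sub_mul_inv_sub_mul_inv_sub (hx : γ.Encloses x) (hy : γ.Encloses y)
    (hw : γ.Encloses w) : γ.residue (fun z => (z - w)⁻¹ * (z - x)⁻¹ * (z - y)⁻¹) = 0 := by
  by_cases hwx : w = x
  · by_cases hwy : w = y
    · subst hwx hwy
      refine residue_eq_zero_of_hasDerivAt (F := fun z => -(1 / 2) * (z - w)⁻¹ ^ 2)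
        (fun z hz => ?_)
        ((hw.continuousOn_inv_sub.fun_mul hw.continuousOn_inv_sub).fun_mul hw.continuousOn_inv_sub)
      have h := ((((hasDerivAt_id z).sub_const w).inv (hw.sub_ne_zero z hz)).pow 2).const_mul
        (-(1 / 2) : ℂ)
      refine h.congr_deriv ?_
      have := hw.sub_ne_zero z hz
      simp only [id, Pi.inv_apply]
      norm_num
      field_simp
    · have hne : w - y ≠ 0 := _root_.sub_ne_zero.2 hwy
      have h1 : EqOn (fun z => (z - w)⁻¹ * (z - x)⁻¹ * (z - y)⁻¹)
          (fun z => (w - y)⁻¹ * ((z - w)⁻¹ * (z - x)⁻¹ - (z - y)⁻¹ * (z - x)⁻¹)) γ.image := by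
        intro z hz
        have h1 := hx.sub_ne_zero z hz
        have h2 := hy.sub_ne_zero z hz
        have h3 := hw.sub_ne_zero z hz
        simp only
        field_simp
        ring
      rw [residue_congr h1, residue_const_mul,
        residue_sub (hw.continuousOn_inv_sub.fun_mul hx.continuousOn_inv_sub)
          (hy.continuousOn_inv_sub.fun_mul hx.continuousOn_inv_sub),
        hw.residue_inv_sub_mul_inv_sub hx, hy.residue_inv_sub_mul_inv_sub hx]
      simp
  · have hne : w - x ≠ 0 := _root_.sub_ne_zero.2 hwx
    have h1 : EqOn (fun z => (z - w)⁻¹ * (z - x)⁻¹ * (z - y)⁻¹)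
        (fun z => (w - x)⁻¹ * ((z - w)⁻¹ * (z - y)⁻¹ - (z - x)⁻¹ * (z - y)⁻¹)) γ.image := by
      intro z hz
      have h1 := hx.sub_ne_zero z hz
      have h2 := hy.sub_ne_zero z hz
      have h3 := hw.sub_ne_zero z hz
      simp only
      field_simp
      ring
    rw [residue_congr h1, residue_const_mul,
      residue_sub (hw.continuousOn_inv_sub.fun_mul hy.continuousOn_inv_sub)
        (hx.continuousOn_inv_sub.fun_mul hy.continuousOn_inv_sub),
      hw.residue_inv_sub_mul_inv_sub hy, hx.residue_inv_sub_mul_inv_sub hy]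
    simp

end Contour

/-! ### The logarithm of a Möbius function cut along an interval -/

/-- `log ((z - b) / (z - a))`, holomorphic off the interval `[a, b]`. -/
def logRatio (a b : ℝ) (z : ℂ) : ℂ := Complex.log ((z - b) / (z - a))

lemma ofReal_mem_slitPlane {x : ℝ} (hx : 0 < x) : (x : ℂ) ∈ Complex.slitPlane :=
  Complex.ofReal_mem_slitPlane.2 hx

/-- For a < b the Möbius map sends to the nonpositive half-line only points of [a, b]: off the real
axis the imaginary part of the image is nonzero, and on it the sign decides. The degenerate case a =
b, with constant image 1, is needed when the endpoint b moves down to a. -/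
lemma div_mem_slitPlane {a b : ℝ} {z : ℂ} (hab : a ≤ b)
    (hz : ∀ x ∈ Icc a b, z ≠ (x : ℂ)) : (z - b) / (z - a) ∈ Complex.slitPlane := by
  have ha : z - a ≠ 0 := sub_ne_zero.2 (hz a (left_mem_Icc.2 hab))
  have hb : z - b ≠ 0 := sub_ne_zero.2 (hz b (right_mem_Icc.2 hab))
  have hns : 0 < Complex.normSq (z - a) := Complex.normSq_pos.2 ha
  have him : ((z - b) / (z - a)).im = z.im * (b - a) / Complex.normSq (z - a) := by
    rw [Complex.div_im]; simp; field_simp; ring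
  by_cases h : z.im = 0
  · have hzr : z = (z.re : ℂ) := Complex.ext rfl (by simpa using h)
    rw [hzr, ← Complex.ofReal_sub, ← Complex.ofReal_sub, ← Complex.ofReal_div]
    apply ofReal_mem_slitPlane
    by_cases hlt : z.re < a
    · exact div_pos_of_neg_of_neg (by linarith) (by linarith)
    · have : b < z.re := by
        by_contra hcon
        exact hz z.re ⟨not_lt.1 hlt, not_lt.1 hcon⟩ hzr
      exact div_pos (by linarith) (by linarith)
  · rcases hab.eq_or_lt with rfl | hlt
    · rw [div_self ha]; exact Complex.one_mem_slitPlane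
    · right
      rw [him]
      exact div_ne_zero (mul_ne_zero h (sub_ne_zero.2 hlt.ne')) hns.ne'

lemma hasDerivAt_logRatio {a b : ℝ} {z : ℂ} (hab : a ≤ b)
    (hz : ∀ x ∈ Icc a b, z ≠ (x : ℂ)) :
    HasDerivAt (logRatio a b) ((z - b)⁻¹ - (z - a)⁻¹) z := by
  have ha : z - a ≠ 0 := sub_ne_zero.2 (hz a (left_mem_Icc.2 hab))
  have hb : z - b ≠ 0 := sub_ne_zero.2 (hz b (right_mem_Icc.2 hab))
  have h := (((hasDerivAt_id z).sub_const (b : ℂ)).div ((hasDerivAt_id z).sub_const (a : ℂ)) ha).clog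
    (div_mem_slitPlane hab hz)
  refine h.congr_deriv ?_
  simp only [id, Pi.div_apply]
  field_simp

lemma exp_logRatio {a b : ℝ} {z : ℂ} (hab : a ≤ b) (hz : ∀ x ∈ Icc a b, z ≠ (x : ℂ)) :
    Complex.exp (logRatio a b z) = (z - b) / (z - a) :=
  Complex.exp_log (Complex.slitPlane_ne_zero (div_mem_slitPlane hab hz))

/-- As a function of its right endpoint x, the logarithm vanishes at x = a and has derivative -(z -
x)⁻¹. -/
lemma logRatio_eq_integral {a b : ℝ} {z : ℂ} (hab : a ≤ b) (hz : ∀ x ∈ Icc a b, z ≠ (x : ℂ)) :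
    logRatio a b z = -∫ x in a..b, (z - (x : ℂ))⁻¹ := by
  have ha : z - a ≠ 0 := sub_ne_zero.2 (hz a (left_mem_Icc.2 hab))
  have hd : ∀ x ∈ uIcc a b, HasDerivAt (fun x : ℝ => logRatio a x z) (-(z - (x : ℂ))⁻¹) x := by
    intro x hx
    rw [uIcc_of_le hab] at hx
    have hzx : z - x ≠ 0 := sub_ne_zero.2 (hz x hx)
    have h1 : HasDerivAt (fun w : ℂ => Complex.log ((z - w) / (z - a))) (-(z - (x : ℂ))⁻¹) x := by
      have h := (((hasDerivAt_id (x : ℂ)).const_sub z).div_const (z - a)).clog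
        (div_mem_slitPlane hx.1 fun y hy => hz y ⟨hy.1, hy.2.trans hx.2⟩)
      refine h.congr_deriv ?_
      simp only [id]
      field_simp
    exact h1.comp_ofReal
  have hc : ContinuousOn (fun x : ℝ => -(z - (x : ℂ))⁻¹) (uIcc a b) := by
    refine ContinuousOn.neg (ContinuousOn.inv₀ (by fun_prop) fun x hx => ?_)
    rw [uIcc_of_le hab] at hx
    exact sub_ne_zero.2 (hz x hx)
  have := intervalIntegral.integral_eq_sub_of_hasDerivAt hd hc.intervalIntegrable
  rw [intervalIntegral.integral_neg] at this
  rw [this]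
  simp [logRatio, div_self ha]

/-- The integral representation and Fubini trade a branch cut for a family of simple poles on it,
all enclosed by the contour. -/
lemma Contour.residue_logRatio_mul {γ : Contour} {a b : ℝ} (hab : a ≤ b)
    (h : ∀ x ∈ Icc a b, γ.Encloses (x : ℂ)) {g : ℂ → ℂ} (hg : ContinuousOn g γ.image) :
    γ.residue (fun z => logRatio a b z * g z) =
      -∫ x in a..b, γ.residue (fun z => g z * (z - (x : ℂ))⁻¹) := by
  have hk : ContinuousOn (Function.uncurry fun (x : ℝ) (z : ℂ) => g z * (z - (x : ℂ))⁻¹)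
      (Icc a b ×ˢ γ.image) := by
    refine ContinuousOn.mul (hg.comp continuousOn_snd fun p hp => hp.2) ?_
    exact ContinuousOn.inv₀ (by fun_prop) fun p hp => (h p.1 hp.1).sub_ne_zero p.2 hp.2
  rw [← Contour.residue_intervalIntegral hab hk, ← Contour.residue_neg]
  refine Contour.residue_congr fun z hz => ?_
  rw [logRatio_eq_integral hab fun x hx hzx => (h x hx).notMem_image (hzx ▸ hz),
    intervalIntegral.integral_const_mul]
  ring

/-! ### The dilogarithm -/

/-- An integrable majorant on [0, 1]: below 1/2 one has |log(1 - y)| ≤ 2y, and above 1/2 one has y⁻¹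
≤ 2. -/
lemma abs_inv_mul_log_one_sub_le {y : ℝ} (h0 : 0 ≤ y) (h1 : y ≤ 1) :
    |y⁻¹ * Real.log (1 - y)| ≤ 2 + 2 * |Real.log (1 - y)| := by
  rw [abs_mul, abs_inv, abs_of_nonneg h0]
  have hl := abs_nonneg (Real.log (1 - y))
  rcases h0.eq_or_lt with rfl | hpos
  · simp
  rcases le_total y (1 / 2) with h | h
  · have h3 : 0 < 1 - y := by linarith
    have h4 : 1 - (1 - y)⁻¹ ≤ Real.log (1 - y) := Real.one_sub_inv_le_log_of_pos h3
    have h5 : Real.log (1 - y) ≤ 0 := Real.log_nonpos h3.le (by linarith)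
    have h6 : (1 - y)⁻¹ ≤ 1 + 2 * y := by
      rw [inv_le_iff_one_le_mul₀ h3]; nlinarith
    have h7 : |Real.log (1 - y)| ≤ 2 * y := by rw [abs_of_nonpos h5]; linarith
    have h8 : y⁻¹ * |Real.log (1 - y)| ≤ y⁻¹ * (2 * y) := by gcongr
    have h9 : y⁻¹ * (2 * y) = 2 := by field_simp
    linarith
  · have h2 : y⁻¹ ≤ 2 := by rw [inv_le_iff_one_le_mul₀ hpos]; linarith
    nlinarith [mul_le_mul_of_nonneg_right h2 hl]

lemma intervalIntegrable_Li2 : IntervalIntegrable (fun y => y⁻¹ * Real.log (1 - y)) volume 0 1 := by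
  have h1 : IntervalIntegrable (fun y => Real.log (1 - y)) volume 0 1 := by
    have := (intervalIntegral.intervalIntegrable_log' (a := 0) (b := 1)).comp_sub_left 1
    simpa using this.symm
  have h2 : IntervalIntegrable (fun y => 2 + 2 * |Real.log (1 - y)|) volume 0 1 :=
    intervalIntegrable_const.add (h1.abs.const_mul 2)
  refine h2.mono_fun ?_ ?_
  · exact (measurable_inv.mul (Real.measurable_log.comp
      (measurable_const.sub measurable_id))).aestronglyMeasurable
  · rw [uIoc_of_le zero_le_one]
    filter_upwards [ae_restrict_mem measurableSet_Ioc] with y hy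
    rw [Real.norm_eq_abs, Real.norm_eq_abs]
    exact (abs_inv_mul_log_one_sub_le hy.1.le hy.2).trans (le_abs_self _)

lemma continuousOn_Li2 : ContinuousOn Li2 (Icc 0 1) := by
  have := intervalIntegral.continuousOn_primitive_interval' intervalIntegrable_Li2
    (left_mem_uIcc)
  rw [uIcc_of_le zero_le_one] at this
  exact this.neg

lemma hasDerivAt_Li2 {x : ℝ} (h0 : 0 < x) (h1 : x < 1) :
    HasDerivAt Li2 (-(x⁻¹ * Real.log (1 - x))) x := by
  refine (intervalIntegral.integral_hasDerivAt_right ?_ ?_ ?_).neg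
  · refine intervalIntegrable_Li2.mono_set ?_
    rw [uIcc_of_le h0.le, uIcc_of_le zero_le_one]
    exact Icc_subset_Icc_right h1.le
  · exact (measurable_inv.mul (Real.measurable_log.comp
      (measurable_const.sub measurable_id))).stronglyMeasurable.stronglyMeasurableAtFilter
  · exact (continuousAt_inv₀ h0.ne').mul
      ((continuousAt_const.sub continuousAt_id).log (by simp; linarith))

/-- Termwise integration of ∑ yⁿ/(n + 1) gives ∑ 1/(n + 1)² = ζ(2). -/
lemma Li2_one : Li2 1 = Real.pi ^ 2 / 6 := by
  have hsum : HasSum (fun n : ℕ => ∫ y in (0 : ℝ)..1, y ^ n / (n + 1)) (Real.pi ^ 2 / 6) := by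
    have h := (hasSum_nat_add_iff' 1).2 hasSum_zeta_two
    simp only [Finset.range_one, Finset.sum_singleton, Nat.cast_zero, ne_eq, OfNat.ofNat_ne_zero,
      not_false_eq_true, zero_pow, div_zero, sub_zero] at h
    refine h.congr_fun fun n => ?_
    have : (n : ℝ) + 1 ≠ 0 := by positivity
    rw [intervalIntegral.integral_div, integral_pow]
    push_cast
    field_simp
    simp
  have hint : ∀ n : ℕ, IntervalIntegrable (fun y : ℝ => y ^ n / (n + 1)) volume 0 1 := fun n =>
    Continuous.intervalIntegrable (by fun_prop) _ _
  have h := hasSum_integral_of_summable_integral_norm (μ := volume.restrict (Ioc (0 : ℝ) 1))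
    (F := fun (n : ℕ) (y : ℝ) => y ^ n / (n + 1))
    (fun n => (intervalIntegrable_iff_integrableOn_Ioc_of_le zero_le_one).1 (hint n)) (by
      refine hsum.summable.congr fun n => ?_
      rw [intervalIntegral.integral_of_le zero_le_one]
      refine setIntegral_congr_fun measurableSet_Ioc fun y hy => ?_
      have := hy.1.le
      exact (Real.norm_of_nonneg (by positivity)).symm)
  have h' : HasSum (fun n : ℕ => ∫ y in (0 : ℝ)..1, y ^ n / (n + 1)) (Li2 1) := by
    have e1 : Li2 1 = ∫ y in Ioc (0 : ℝ) 1, ∑' n : ℕ, y ^ n / ((n : ℝ) + 1) := by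
      rw [Li2, intervalIntegral.integral_of_le zero_le_one, ← MeasureTheory.integral_neg,
        integral_Ioc_eq_integral_Ioo, integral_Ioc_eq_integral_Ioo]
      refine setIntegral_congr_fun measurableSet_Ioo fun y hy => ?_
      have hy0 : y ≠ 0 := hy.1.ne'
      have := (Real.hasSum_pow_div_log_of_abs_lt_one (x := y)
        (by rw [abs_of_pos hy.1]; exact hy.2)).mul_left y⁻¹
      rw [← mul_neg, ← this.tsum_eq]
      refine tsum_congr fun n => ?_
      field_simp
      ring
    rw [e1]
    simpa only [intervalIntegral.integral_of_le zero_le_one] using h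
  exact h'.unique hsum

/-- Both branches have the same derivative because `Real.log` is log|·|: for x > 1, log(1 - x⁻¹) =
log|1 - x| - log x. -/
lemma hasDerivAt_Phi2 {x : ℝ} (h0 : 0 < x) (h1 : x ≠ 1) :
    HasDerivAt Phi2 (-(x⁻¹ * Real.log (1 - x))) x := by
  rcases lt_or_gt_of_ne h1 with h | h
  · refine (hasDerivAt_Li2 h0 h).congr_of_eventuallyEq ?_
    filter_upwards [Iio_mem_nhds h] with y hy using if_pos hy
  · have hinv : HasDerivAt (fun y => Li2 y⁻¹)
        (-(x⁻¹⁻¹ * Real.log (1 - x⁻¹)) * (-(x ^ 2)⁻¹)) x :=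
      (hasDerivAt_Li2 (inv_pos.2 h0) (inv_lt_one_of_one_lt₀ h)).comp x (hasDerivAt_inv h0.ne')
    have hd := ((((Real.hasDerivAt_log h0.ne').pow 2).const_mul (1 / 2)).const_sub
      (Real.pi ^ 2 / 3)).sub hinv
    have hlog : Real.log (1 - x⁻¹) = Real.log (1 - x) - Real.log x := by
      rw [← Real.log_neg_eq_log (1 - x), ← Real.log_div (by linarith) h0.ne']
      congr 1
      field_simp
      ring
    refine (hd.congr_deriv ?_).congr_of_eventuallyEq ?_
    · rw [hlog]
      field_simp
      ring
    · filter_upwards [Ioi_mem_nhds h] with y hy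
      simp [Phi2, not_lt.2 (le_of_lt (mem_Ioi.1 hy))]

/-- The constant π²/3 equals 2 Li₂(1), which makes the two branches of Φ₂ agree at 1. -/
lemma Phi2_one : Phi2 1 = Li2 1 := by
  simp only [Phi2, lt_self_iff_false, if_false, Real.log_one, inv_one, Li2_one]
  ring

lemma continuousOn_Phi2 : ContinuousOn Phi2 (Ioi 0) := by
  intro x hx
  apply ContinuousAt.continuousWithinAt
  by_cases h : x = 1
  · subst h
    rw [continuousAt_iff_continuous_left_right]
    constructor
    · have h1 : ContinuousWithinAt Li2 (Iic 1) 1 :=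
        (continuousOn_Li2 1 (right_mem_Icc.2 zero_le_one)).mono_of_mem_nhdsWithin
          (Icc_mem_nhdsLE zero_lt_one)
      refine h1.congr (fun y hy => ?_) Phi2_one
      rcases (mem_Iic.1 hy).eq_or_lt with rfl | h
      · exact Phi2_one
      · exact if_pos h
    · have h1 : ContinuousWithinAt Li2 (Icc 0 1) (1 : ℝ)⁻¹ := by
        rw [inv_one]; exact continuousOn_Li2 1 (right_mem_Icc.2 zero_le_one)
      have h2 : ContinuousWithinAt (fun y => Li2 y⁻¹) (Ici 1) 1 :=
        h1.comp (continuousAt_inv₀ one_ne_zero).continuousWithinAt fun y hy =>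
          ⟨inv_nonneg.2 (zero_le_one.trans hy), inv_le_one_of_one_le₀ hy⟩
      have h3 : ContinuousWithinAt
          (fun y => Real.pi ^ 2 / 3 - (1 / 2) * Real.log y ^ 2 - Li2 y⁻¹) (Ici 1) 1 :=
        (continuousWithinAt_const.sub (continuousWithinAt_const.mul
          ((Real.continuousAt_log one_ne_zero).continuousWithinAt.pow 2))).sub h2
      exact h3.congr (fun y hy => if_neg (not_lt.2 hy)) (if_neg (lt_irrefl 1))
  · exact (hasDerivAt_Phi2 hx h).continuousAt

/-! ### A primitive of log t/(t - 1), continuous through t = 1 -/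

lemma continuousOn_dslope_log : ContinuousOn (dslope Real.log 1) (Ioi 0) := by
  rw [continuousOn_dslope (Ioi_mem_nhds zero_lt_one)]
  exact ⟨Real.continuousOn_log.mono fun x hx => (ne_of_gt hx),
    Real.differentiableAt_log one_ne_zero⟩

/-- A primitive of `log t / (t - 1)` on the positive half-line. -/
def dilogPrimitive (t : ℝ) : ℝ := Phi2 t + Real.log t * Real.log (1 - t)

lemma continuousOn_dilogPrimitive : ContinuousOn dilogPrimitive (Ioi 0) := by
  -- The factor log t vanishes at 1 and absorbs the singularity of log|1 - t|: the product is a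
  -- continuous divided difference times u log u with u = t - 1.
  have h : ∀ t, Real.log t * Real.log (1 - t) =
      dslope Real.log 1 t * ((t - 1) * Real.log (t - 1)) := by
    intro t
    have := sub_smul_dslope Real.log 1 t
    simp only [Real.log_one, sub_zero, smul_eq_mul] at this
    rw [← this, ← Real.log_neg_eq_log (1 - t), neg_sub]
    ring
  refine continuousOn_Phi2.add ?_
  simp only [h]
  exact continuousOn_dslope_log.mul
    (Real.continuous_mul_log.comp (continuous_id.sub continuous_const)).continuousOn

lemma hasDerivAt_dilogPrimitive {t : ℝ} (h0 : 0 < t) (h1 : t ≠ 1) :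
    HasDerivAt dilogPrimitive (dslope Real.log 1 t) t := by
  have h1' : 1 - t ≠ 0 := sub_ne_zero.2 h1.symm
  have h1'' : t - 1 ≠ 0 := sub_ne_zero.2 h1
  have h := (hasDerivAt_Phi2 h0 h1).add ((Real.hasDerivAt_log h0.ne').mul
    (((hasDerivAt_id t).const_sub 1).log h1'))
  refine h.congr_deriv ?_
  rw [dslope_of_ne _ h1, slope_def_field]
  simp only [id, Real.log_one]
  field_simp
  ring

lemma integral_dslope_log {a b w : ℝ} (ha : 0 < a) (hab : a ≤ b) (hw : 0 < w) :
    ∫ x in a..b, dslope Real.log w x = dilogPrimitive (b / w) - dilogPrimitive (a / w) := by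
  have hmaps : MapsTo (fun x => x / w) (Icc a b) (Ioi 0) := fun x hx =>
    div_pos (ha.trans_le hx.1) hw
  refine MeasureTheory.integral_eq_of_hasDerivAt_off_countable_of_le
    -- The point w may lie in [a, b]; differentiability may fail there, but continuity of the
    -- primitive suffices.
    (fun x => dilogPrimitive (x / w)) _ hab (countable_singleton w) ?_ ?_ ?_
  · exact continuousOn_dilogPrimitive.comp (by fun_prop) hmaps
  · intro x hx
    have hxw : x ≠ w := hx.2
    have hx0 : 0 < x := ha.trans hx.1.1
    have hne : x / w ≠ 1 := by rwa [ne_eq, div_eq_one_iff_eq hw.ne']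
    have h := (hasDerivAt_dilogPrimitive (div_pos hx0 hw) hne).comp x
      ((hasDerivAt_id x).div_const w)
    refine h.congr_deriv ?_
    have : x - w ≠ 0 := sub_ne_zero.2 hxw
    have h2 : x / w - 1 ≠ 0 := sub_ne_zero.2 hne
    rw [dslope_of_ne _ hne, dslope_of_ne _ hxw, slope_def_field, slope_def_field,
      Real.log_div hx0.ne' hw.ne', Real.log_one]
    have h3 : x / w - 1 = (x - w) / w := by field_simp
    rw [h3]
    field_simp
    ring
  · apply ContinuousOn.intervalIntegrable
    rw [uIcc_of_le hab]
    have : ContinuousOn (dslope Real.log w) (Ioi 0) := by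
      rw [continuousOn_dslope (Ioi_mem_nhds hw)]
      exact ⟨Real.continuousOn_log.mono fun x hx => (ne_of_gt hx),
        Real.differentiableAt_log hw.ne'⟩
    exact this.mono fun x hx => ha.trans_le hx.1

lemma dslope_clog_ofReal {w x : ℝ} (hw : 0 < w) (hx : 0 < x) :
    dslope Complex.log (w : ℂ) (x : ℂ) = (dslope Real.log w x : ℝ) := by
  by_cases h : x = w
  · subst h
    rw [dslope_same, dslope_same, (Complex.hasDerivAt_log (ofReal_mem_slitPlane hx)).deriv,
      Real.deriv_log]
    push_cast
    rfl
  · rw [dslope_of_ne _ h, dslope_of_ne _ (by exact_mod_cast h), slope_def_field, slope_def_field]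
    push_cast
    rw [Complex.ofReal_log hx.le, Complex.ofReal_log hw.le]

/-! ### The roots of the secular equation -/

-- Both sides are monic of degree M in z, so their difference has degree less than M; it vanishes at
-- the M distinct points u_k.
open Polynomial in
lemma prod_sub_add_sum_eq_prod_sub {K : Type*} [Field K] {M : ℕ} (a c u : Fin M → K)
    (hu : Function.Injective u)
    (hroot : ∀ k, ∏ m, (u k - a m) + ∑ j, c j * ∏ m ∈ Finset.univ.erase j, (u k - a m) = 0)
    (z : K) :
    ∏ m, (z - a m) + ∑ j, c j * ∏ m ∈ Finset.univ.erase j, (z - a m) = ∏ m, (z - u m) := by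
  rcases Nat.eq_zero_or_pos M with rfl | hM
  · simp
  have hdeg : ∀ (s : Finset (Fin M)) (b : Fin M → K),
      (∏ m ∈ s, (X - C (b m))).degree = (s.card : WithBot ℕ) := by
    intro s b
    rw [degree_prod_of_monic _ _ fun i _ => monic_X_sub_C _]
    simp
  have key : ∏ m, (X - C (a m)) + ∑ j, C (c j) * ∏ m ∈ Finset.univ.erase j, (X - C (a m)) =
      ∏ m, (X - C (u m)) := by
    refine eq_of_degree_sub_lt_of_eval_index_eq Finset.univ (v := u) hu.injOn ?_ ?_
    · have h1 : (∏ m, (X - C (a m)) - ∏ m, (X - C (u m))).degree < (M : WithBot ℕ) := by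
        have hm : ∀ b : Fin M → K, (∏ m, (X - C (b m))).Monic := fun b =>
          monic_prod_of_monic _ _ fun i _ => monic_X_sub_C _
        have := degree_sub_lt_left (p := ∏ m, (X - C (a m))) (q := ∏ m, (X - C (u m)))
          (by rw [hdeg, hdeg]) (hm a).ne_zero (by rw [(hm a).leadingCoeff, (hm u).leadingCoeff])
        rwa [hdeg, Finset.card_univ, Fintype.card_fin] at this
      have h2 : (∑ j, C (c j) * ∏ m ∈ Finset.univ.erase j, (X - C (a m))).degree <
          (M : WithBot ℕ) := by
        refine (degree_sum_le _ _).trans_lt ((Finset.sup_lt_iff (WithBot.bot_lt_coe M)).2 ?_)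
        intro j _
        rw [← smul_eq_C_mul]
        refine (degree_smul_le _ _).trans_lt ?_
        rw [hdeg, Finset.card_erase_of_mem (Finset.mem_univ j), Finset.card_univ, Fintype.card_fin]
        exact Nat.cast_lt.2 (Nat.sub_lt hM one_pos)
      rw [add_sub_right_comm, Finset.card_univ, Fintype.card_fin]
      exact (degree_add_le _ _).trans_lt (max_lt h1 h2)
    · intro k _
      have h0 : ∏ m, (u k - u m) = 0 := Finset.prod_eq_zero (Finset.mem_univ k) (sub_self _)
      simp only [eval_add, eval_prod, eval_sub, eval_X, eval_C, eval_finsetSum, eval_mul, h0]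
      exact hroot k
  have := congrArg (eval z) key
  simpa [eval_prod, eval_finsetSum] using this

lemma prod_mul_one_add_sum {K : Type*} [Field K] {M : ℕ} (a c : Fin M → K) {z : K}
    (hz : ∀ k, z ≠ a k) :
    (∏ m, (z - a m)) * (1 + ∑ k, c k * (z - a k)⁻¹) =
      ∏ m, (z - a m) + ∑ j, c j * ∏ m ∈ Finset.univ.erase j, (z - a m) := by
  rw [mul_add, mul_one, Finset.mul_sum]
  congr 1
  refine Finset.sum_congr rfl fun j _ => ?_
  have := sub_ne_zero.2 (hz j)
  rw [← Finset.mul_prod_erase _ _ (Finset.mem_univ j)]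
  field_simp

/-- The partial fraction expansion of a rational function with simple poles and known zeros. -/
lemma one_add_sum_eq_prod_div {K : Type*} [Field K] {M : ℕ} (a c u : Fin M → K)
    (hu : Function.Injective u) (hua : ∀ k m, u k ≠ a m)
    (hroot : ∀ k, 1 + ∑ j, c j * (u k - a j)⁻¹ = 0) {z : K} (hz : ∀ k, z ≠ a k) :
    1 + ∑ j, c j * (z - a j)⁻¹ = ∏ k, ((z - u k) / (z - a k)) := by
  rw [Finset.prod_div_distrib, eq_div_iff (Finset.prod_ne_zero_iff.2 fun k _ =>
    sub_ne_zero.2 (hz k)), mul_comm, prod_mul_one_add_sum a c hz]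
  refine prod_sub_add_sum_eq_prod_sub a c u hu (fun k => ?_) z
  rw [← prod_mul_one_add_sum a c (hua k), hroot k, mul_zero]

section Roots

variable {M N : ℕ} {lam mu : Fin M → ℝ}

/-- `1 - N⁻¹ ∑ₖ λₖ / (λₖ - x)`. -/
def secular (N : ℕ) (lam : Fin M → ℝ) (x : ℝ) : ℝ := 1 - (1 / (N : ℝ)) * ∑ k, lam k / (lam k - x)

/-- As x → λ_k the product tends to -λ_k/N, the only contribution of the pole. So the secular
function is negative just left of λ_k and positive just right of it. -/
lemma eventually_secular_neg (hN : 0 < N) (hpos : ∀ k, 0 < lam k) (hlam : StrictMono lam)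
    (k : Fin M) : ∀ᶠ x in 𝓝[≠] lam k, (lam k - x) * secular N lam x < 0 := by
  have hN' : (0 : ℝ) < N := by exact_mod_cast hN
  have hc : ContinuousAt (fun x => (lam k - x) * (1 - (1 / (N : ℝ)) *
      ∑ m ∈ Finset.univ.erase k, lam m / (lam m - x)) - lam k / N) (lam k) := by
    refine ContinuousAt.sub (ContinuousAt.mul (by fun_prop) (ContinuousAt.sub (by fun_prop)
      (ContinuousAt.mul (by fun_prop) (tendsto_finsetSum _ fun m hm => ?_)))) (by fun_prop)
    exact ContinuousAt.div (by fun_prop) (by fun_prop)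
      (sub_ne_zero.2 (hlam.injective.ne (Finset.ne_of_mem_erase hm)))
  have hneg : (lam k - lam k) * (1 - (1 / (N : ℝ)) *
      ∑ m ∈ Finset.univ.erase k, lam m / (lam m - lam k)) - lam k / N < 0 := by
    rw [sub_self, zero_mul, zero_sub]
    exact neg_neg_of_pos (div_pos (hpos k) hN')
  filter_upwards [nhdsWithin_le_nhds (hc.eventually (gt_mem_nhds hneg)), self_mem_nhdsWithin]
    with x hx hxk
  have hxk' : lam k - x ≠ 0 := sub_ne_zero.2 (Ne.symm hxk)
  have : (lam k - x) * secular N lam x = (lam k - x) * (1 - (1 / (N : ℝ)) *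
      ∑ m ∈ Finset.univ.erase k, lam m / (lam m - x)) - lam k / N := by
    rw [secular, ← Finset.add_sum_erase _ _ (Finset.mem_univ k)]
    field_simp
    ring
  rwa [this]

lemma exists_secular_eq_zero (hN : M < N) (hpos : ∀ k, 0 < lam k) (hlam : StrictMono lam)
    (k : Fin M) :
    ∃ x, 0 < x ∧ x < lam k ∧ (∀ m, m < k → lam m < x) ∧ secular N lam x = 0 := by
  have hN0 : 0 < N := by omega
  obtain ⟨p, hp0, hpk, hpm, hp⟩ : ∃ p, 0 ≤ p ∧ p < lam k ∧ (∀ m, m < k → lam m < p) ∧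
      0 < secular N lam p := by
    by_cases hk : k.val = 0
    · refine ⟨0, le_rfl, hpos k, fun m hm => absurd hm (by simp [Fin.lt_def, hk]), ?_⟩
      have h1 : ∀ m, lam m / (lam m - 0) = 1 := fun m => by rw [sub_zero, div_self (hpos m).ne']
      have hN' : (0 : ℝ) < N := by exact_mod_cast hN0
      have hMN : (M : ℝ) < N := by exact_mod_cast hN
      simp only [secular, h1, Finset.sum_const, Finset.card_univ, Fintype.card_fin, nsmul_eq_mul,
        mul_one, sub_pos]
      rw [one_div, inv_mul_lt_iff₀ hN', mul_one]
      exact hMN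
    · let k' : Fin M := ⟨k.val - 1, by omega⟩
      have hk' : k' < k := Fin.lt_def.2 (by simp only [k']; omega)
      have h1 := nhdsWithin_mono _ (fun x (hx : x ∈ Ioi (lam k')) => ne_of_gt hx)
        (eventually_secular_neg hN0 hpos hlam k')
      have h2 : ∀ᶠ x in 𝓝[>] lam k', x < lam k :=
        nhdsWithin_le_nhds (gt_mem_nhds (hlam hk'))
      obtain ⟨p, ⟨hp1, hp2⟩, hp3⟩ :=
        ((Filter.Eventually.and h1 h2).and self_mem_nhdsWithin).exists
      refine ⟨p, ((hpos k').trans hp3).le, hp2, fun m hm => lt_of_le_of_lt (hlam.monotone ?_) hp3, ?_⟩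
      · exact Fin.le_def.2 (by simp only [k']; have := Fin.lt_def.1 hm; omega)
      · exact pos_of_mul_neg_right hp1 (sub_nonpos.2 (le_of_lt hp3))
  obtain ⟨q, ⟨hq1, hq2⟩, hq3⟩ := ((Filter.Eventually.and
    (nhdsWithin_mono _ (fun x (hx : x ∈ Iio (lam k)) => ne_of_lt hx)
      (eventually_secular_neg hN0 hpos hlam k))
    (nhdsWithin_le_nhds (lt_mem_nhds hpk) : ∀ᶠ x in 𝓝[<] lam k, p < x)).and
      self_mem_nhdsWithin).exists
  have hq : secular N lam q < 0 := neg_of_mul_neg_right hq1 (sub_nonneg.2 (le_of_lt hq3))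
  have hc : ContinuousOn (secular N lam) (Icc p q) := by
    refine continuousOn_const.sub (continuousOn_const.mul (continuousOn_finsetSum _ fun m _ => ?_))
    refine continuousOn_const.div (by fun_prop) fun x hx => sub_ne_zero.2 ?_
    rcases lt_or_ge m k with h | h
    · exact ((hpm m h).trans_le hx.1).ne
    · exact ((hx.2.trans_lt hq3).trans_le (hlam.monotone h)).ne'
  -- The interval [p, q] contains no eigenvalue, and the secular function is positive at p and
  -- negative at q.
  obtain ⟨x, hx, hx0⟩ := intermediate_value_Ioo' hq2.le hc ⟨hq, hp⟩
  exact ⟨x, hp0.trans_lt hx.1, hx.2.trans hq3, fun m hm => (hpm m hm).trans hx.1, hx0⟩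

/-- The eigenvalues are positive, and separated by the roots of the secular equation. -/
structure Interlaced (N : ℕ) (lam mu : Fin M → ℝ) : Prop where
  lt_N : M < N
  pos : ∀ k, 0 < mu k
  lt : ∀ k, mu k < lam k
  lt_of_lt : ∀ m k, m < k → lam m < mu k
  secular_eq : ∀ k, secular N lam (mu k) = 0

namespace Interlaced

lemma lam_pos (h : Interlaced N lam mu) (k : Fin M) : 0 < lam k := (h.pos k).trans (h.lt k)

lemma strictMono_mu (h : Interlaced N lam mu) : StrictMono mu :=
  fun _ _ hmk => (h.lt _).trans (h.lt_of_lt _ _ hmk)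

lemma strictMono_lam (h : Interlaced N lam mu) : StrictMono lam :=
  fun _ _ hmk => (h.lt_of_lt _ _ hmk).trans (h.lt _)

lemma mu_ne_lam (h : Interlaced N lam mu) (k m : Fin M) : mu k ≠ lam m := by
  rcases lt_or_ge m k with hmk | hmk
  · exact (h.lt_of_lt _ _ hmk).ne'
  · exact ((h.lt k).trans_le (h.strictMono_lam.monotone hmk)).ne

lemma N_pos (h : Interlaced N lam mu) : (0 : ℝ) < N := by
  exact_mod_cast (Nat.zero_le M).trans_lt h.lt_N

lemma one_add_sum_eq_zero (h : Interlaced N lam mu) (k : Fin M) :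
    1 + ∑ j, lam j / N * (mu k - lam j)⁻¹ = 0 := by
  rw [← h.secular_eq k, secular, sub_eq_add_neg, Finset.mul_sum, ← Finset.sum_neg_distrib]
  congr 1
  refine Finset.sum_congr rfl fun j _ => ?_
  rw [← neg_sub (lam j) (mu k), inv_neg]
  ring

/-- In product form, ∏ (x - μ_k)/(x - λ_k) visibly has no zeros besides the μ_k. -/
lemma isRootList (h : Interlaced N lam mu) : IsRootList N lam mu := by
  refine ⟨h.strictMono_mu, Set.ext fun x => ⟨?_, ?_⟩⟩
  · rintro ⟨k, rfl⟩
    exact ⟨h.mu_ne_lam k, sub_eq_zero.1 (h.secular_eq k)⟩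
  · rintro ⟨hx, hx1⟩
    have h1 := one_add_sum_eq_prod_div lam (fun j => lam j / N) mu h.strictMono_mu.injective
      h.mu_ne_lam h.one_add_sum_eq_zero hx
    have h2 : 1 + ∑ j, lam j / N * (x - lam j)⁻¹ = 0 := by
      rw [← sub_eq_zero.2 hx1, sub_eq_add_neg, Finset.mul_sum, ← Finset.sum_neg_distrib]
      congr 1
      refine Finset.sum_congr rfl fun j _ => ?_
      rw [← neg_sub (lam j) x, inv_neg]
      ring
    rw [h2, eq_comm, Finset.prod_eq_zero_iff] at h1
    obtain ⟨k, -, hk⟩ := h1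
    exact ⟨k, (sub_eq_zero.1 ((div_eq_zero_iff.1 hk).resolve_right (sub_ne_zero.2 (hx k)))).symm⟩

end Interlaced

lemma exists_interlaced (hN : M < N) (hpos : ∀ k, 0 < lam k) (hlam : StrictMono lam) :
    ∃ mu, Interlaced N lam mu := by
  choose mu h0 h1 h2 h3 using exists_secular_eq_zero hN hpos hlam
  exact ⟨mu, hN, h0, h1, fun m k hmk => h2 k m hmk, h3⟩

lemma IsRootList.unique {mu' : Fin M → ℝ} (h : IsRootList N lam mu) (h' : IsRootList N lam mu') :
    mu = mu' :=
  (h.1.range_inj h'.1).1 (h.2.trans h'.2.symm)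

lemma IsRootList.interlaced (h : IsRootList N lam mu) (hN : M < N) (hpos : ∀ k, 0 < lam k)
    (hlam : StrictMono lam) : Interlaced N lam mu := by
  obtain ⟨mu', h'⟩ := exists_interlaced hN hpos hlam
  rwa [h.unique h'.isRootList]

end Roots

/-! ### The logarithm of `ω̂` -/

/-- The intervals [a_k, b_k] lie in order in [A, B] without overlapping, so the increments of a
monotone function over them add up to at most its total increment. -/
lemma sum_sub_le_of_monotone {θ : ℝ → ℝ} (hθ : Monotone θ) {A : ℝ} :
    ∀ {M : ℕ} {a b : Fin M → ℝ} {B : ℝ}, (∀ k, A ≤ a k) → (∀ k, a k ≤ b k) → (∀ k, b k ≤ B) →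
      (∀ m k, m < k → b m ≤ a k) → A ≤ B → ∑ k, (θ (b k) - θ (a k)) ≤ θ B - θ A := by
  intro M
  induction M with
  | zero => intro a b B _ _ _ _ hAB; simpa using hθ hAB
  | succ M ih =>
    intro a b B hA hab hB hba hAB
    rw [Fin.sum_univ_castSucc]
    have h1 := ih (a := fun k => a k.castSucc) (b := fun k => b k.castSucc) (B := a (Fin.last M))
      (fun k => hA _) (fun k => hab _) (fun k => hba _ _ (Fin.castSucc_lt_last k))
      (fun m k hmk => hba _ _ (Fin.castSucc_lt_castSucc_iff.2 hmk)) (hA _)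
    have h2 := hθ (hB (Fin.last M))
    linarith

lemma im_sub_div_sub (z : ℂ) (a b : ℝ) :
    ((z - b) / (z - a)).im = z.im * (b - a) / Complex.normSq (z - a) := by
  rw [Complex.div_im]
  simp
  ring

/-- In the upper half-plane both arguments lie in [0, π), so their difference needs no multiple of
2π. -/
lemma logRatio_eq_sub_of_im_pos {z : ℂ} (hz : 0 < z.im) (a b : ℝ) :
    logRatio a b z = Complex.log (z - b) - Complex.log (z - a) := by
  have hb : 0 < (z - b).im := by simpa using hz
  have ha : 0 < (z - a).im := by simpa using hz
  have hb0 : z - b ≠ 0 := fun h => by simp [h] at hb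
  have ha0 : z - a ≠ 0 := fun h => by simp [h] at ha
  have h1 : 0 ≤ (z - b).arg := Complex.arg_nonneg_iff.2 hb.le
  have h2 : 0 ≤ (z - a).arg := Complex.arg_nonneg_iff.2 ha.le
  have h3 : (z - b).arg < Real.pi := Complex.arg_lt_pi_iff.2 (Or.inr hb.ne')
  have h4 : (z - a).arg < Real.pi := Complex.arg_lt_pi_iff.2 (Or.inr ha.ne')
  rw [logRatio, div_eq_mul_inv, (Complex.log_mul_eq_add_log_iff hb0 (inv_ne_zero ha0)).2,
    Complex.log_inv _ h4.ne, ← sub_eq_add_neg]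
  rw [Complex.arg_inv, if_neg h4.ne]
  exact ⟨by linarith, by linarith⟩

lemma monotone_arg_sub {z : ℂ} (hz : 0 < z.im) : Monotone fun t : ℝ => (z - t).arg := by
  intro a b hab
  have h := congrArg Complex.im (logRatio_eq_sub_of_im_pos hz a b)
  rw [logRatio, Complex.sub_im, Complex.log_im, Complex.log_im, Complex.log_im] at h
  have h2 : 0 ≤ ((z - b) / (z - a)).arg := by
    rw [Complex.arg_nonneg_iff, im_sub_div_sub]
    exact div_nonneg (mul_nonneg hz.le (sub_nonneg.2 hab)) (Complex.normSq_nonneg _)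
  simp only
  linarith

/-! ### An explicit logarithm of ω̂ on the cut plane -/

section LogOmega

variable {M N : ℕ} {lam mu : Fin M → ℝ}

/-- The slit plane without the intervals `[μₖ, λₖ]`. -/
def cutPlane (lam mu : Fin M → ℝ) : Set ℂ :=
  {z | z ∈ Complex.slitPlane ∧ ∀ k, ∀ x ∈ Icc (mu k) (lam k), z ≠ (x : ℂ)}

lemma isOpen_cutPlane : IsOpen (cutPlane lam mu) := by
  have : cutPlane lam mu =
      Complex.slitPlane ∩ ⋂ k, ((fun x : ℝ => (x : ℂ)) '' Icc (mu k) (lam k))ᶜ := by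
    ext z
    simp only [cutPlane, mem_ofPred_eq, mem_inter_iff, mem_iInter, mem_compl_iff, mem_image,
      not_exists, not_and, ne_eq, eq_comm]
  rw [this]
  exact Complex.isOpen_slitPlane.inter (isOpen_iInter_of_finite fun k =>
    (isCompact_Icc.image Complex.continuous_ofReal).isClosed.isOpen_compl)

/-- `log z + ∑ₖ log ((z - λₖ) / (z - μₖ))`. -/
def logOmega (lam mu : Fin M → ℝ) (z : ℂ) : ℂ :=
  Complex.log z + ∑ k, logRatio (mu k) (lam k) z

/-- The logarithmic derivative of `ω̂`. -/
def logOmegaDeriv (lam mu : Fin M → ℝ) (z : ℂ) : ℂ :=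
  z⁻¹ + ∑ k, ((z - lam k)⁻¹ - (z - mu k)⁻¹)

namespace Interlaced

lemma sub_lam_ne_zero (h : Interlaced N lam mu) {z : ℂ} (hz : z ∈ cutPlane lam mu) (k : Fin M) :
    z - lam k ≠ 0 := sub_ne_zero.2 (hz.2 k _ (right_mem_Icc.2 (h.lt k).le))

lemma sub_mu_ne_zero (h : Interlaced N lam mu) {z : ℂ} (hz : z ∈ cutPlane lam mu) (k : Fin M) :
    z - mu k ≠ 0 := sub_ne_zero.2 (hz.2 k _ (left_mem_Icc.2 (h.lt k).le))

lemma hasDerivAt_logOmega (h : Interlaced N lam mu) {z : ℂ} (hz : z ∈ cutPlane lam mu) :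
    HasDerivAt (logOmega lam mu) (logOmegaDeriv lam mu z) z :=
  (Complex.hasDerivAt_log hz.1).add
    (HasDerivAt.fun_sum fun k _ => hasDerivAt_logRatio (h.lt k).le (hz.2 k))

lemma prod_eq (h : Interlaced N lam mu) {z : ℂ} (hz : ∀ k, z ≠ lam k) :
    ∏ k, ((z - mu k) / (z - lam k)) = 1 + ∑ k, (lam k : ℂ) / N * (z - lam k)⁻¹ := by
  refine (one_add_sum_eq_prod_div (fun k => (lam k : ℂ)) (fun k => (lam k : ℂ) / N)
    (fun k => (mu k : ℂ)) (Complex.ofReal_injective.comp h.strictMono_mu.injective)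
    (fun k m => by exact_mod_cast h.mu_ne_lam k m) (fun k => ?_) hz).symm
  exact_mod_cast congrArg (fun x : ℝ => (x : ℂ)) (h.one_add_sum_eq_zero k)

lemma exp_logOmega (h : Interlaced N lam mu) {z : ℂ} (hz : z ∈ cutPlane lam mu) :
    Complex.exp (logOmega lam mu z) = z / (1 + ∑ k, (lam k : ℂ) / N * (z - lam k)⁻¹) := by
  have hz0 : z ≠ 0 := Complex.slitPlane_ne_zero hz.1
  rw [← h.prod_eq fun k => sub_ne_zero.1 (h.sub_lam_ne_zero hz k), logOmega, Complex.exp_add,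
    Complex.exp_log hz0, Complex.exp_sum, div_eq_mul_inv, ← Finset.prod_inv_distrib]
  congr 1
  refine Finset.prod_congr rfl fun k _ => ?_
  rw [exp_logRatio (h.lt k).le (hz.2 k), inv_div]

/-- The partial fractions of 1/ω̂. They link ∑ (z - λ_k)⁻¹, minus the trace of the resolvent, to
exp(-L), which is what makes the integration by parts for log² possible. -/
lemma exp_neg_logOmega (h : Interlaced N lam mu) {z : ℂ} (hz : z ∈ cutPlane lam mu) :
    Complex.exp (-logOmega lam mu z) =
      (1 - (M : ℂ) / N) * z⁻¹ + (1 / (N : ℂ)) * ∑ k, (z - lam k)⁻¹ := by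
  have hz0 : z ≠ 0 := Complex.slitPlane_ne_zero hz.1
  have hN : (N : ℂ) ≠ 0 := by exact_mod_cast h.N_pos.ne'
  have h1 : ∀ k, (lam k : ℂ) / N * (z - lam k)⁻¹ = z * (1 / (N : ℂ) * (z - lam k)⁻¹) - 1 / N := by
    intro k
    have := h.sub_lam_ne_zero hz k
    field_simp
    ring
  rw [Complex.exp_neg, h.exp_logOmega hz, inv_div]
  simp only [h1, Finset.sum_sub_distrib, ← Finset.mul_sum, Finset.sum_const, Finset.card_univ,
    Fintype.card_fin, nsmul_eq_mul]
  field_simp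
  ring

/-- The imaginary part is arg z plus increments of t ↦ arg(z - t) over disjoint intervals in (0, B],
hence at most arg z + (arg(z - B) - arg z) = arg(z - B) < π. -/
lemma im_logOmega_mem_of_im_pos (h : Interlaced N lam mu) {z : ℂ} (hz : 0 < z.im) :
    0 ≤ (logOmega lam mu z).im ∧ (logOmega lam mu z).im < Real.pi := by
  have him : (logOmega lam mu z).im =
      z.arg + ∑ k, ((z - lam k).arg - (z - mu k).arg) := by
    rw [logOmega, Complex.add_im, Complex.log_im, Complex.im_sum]
    congr 1
    refine Finset.sum_congr rfl fun k _ => ?_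
    rw [logRatio_eq_sub_of_im_pos hz, Complex.sub_im, Complex.log_im, Complex.log_im]
  have hθ := monotone_arg_sub hz
  rw [him]
  constructor
  · exact add_nonneg (Complex.arg_nonneg_iff.2 hz.le)
      (Finset.sum_nonneg fun k _ => sub_nonneg.2 (hθ (h.lt k).le))
  -- The sum is just a convenient nonnegative upper bound B for all eigenvalues.
  · have hB : ∀ k, lam k ≤ ∑ m, lam m := fun k =>
      Finset.single_le_sum (fun m _ => (h.lam_pos m).le) (Finset.mem_univ k)
    have h1 := sum_sub_le_of_monotone hθ (A := 0) (fun k => (h.pos k).le) (fun k => (h.lt k).le) hB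
      (fun m k hmk => (h.lt_of_lt m k hmk).le) (Finset.sum_nonneg fun m _ => (h.lam_pos m).le)
    have h2 : (z - (∑ m, lam m : ℝ)).arg < Real.pi :=
      Complex.arg_lt_pi_iff.2 (Or.inr (by simpa using hz.ne'))
    simp only [Complex.ofReal_zero, sub_zero] at h1
    linarith

open ComplexConjugate in
lemma logOmega_conj (h : Interlaced N lam mu) {z : ℂ} (hz : z ∈ cutPlane lam mu) :
    logOmega lam mu (conj z) = conj (logOmega lam mu z) := by
  have harg : ∀ {w : ℂ}, w ∈ Complex.slitPlane → w.arg ≠ Real.pi := fun hw =>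
    (Complex.mem_slitPlane_iff_arg.1 hw).1
  rw [logOmega, logOmega, map_add, map_sum, Complex.log_conj _ (harg hz.1)]
  congr 1
  refine Finset.sum_congr rfl fun k _ => ?_
  rw [logRatio, logRatio, ← Complex.log_conj _ (harg (div_mem_slitPlane (h.lt k).le (hz.2 k)))]
  simp

/-- The lower half-plane follows by conjugation, and on the real axis the symmetry makes L real. -/
lemma abs_im_logOmega_lt (h : Interlaced N lam mu) {z : ℂ} (hz : z ∈ cutPlane lam mu) :
    |(logOmega lam mu z).im| < Real.pi := by
  rcases lt_trichotomy z.im 0 with hneg | h0 | hpos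
  · have h1 := h.im_logOmega_mem_of_im_pos (z := (starRingEnd ℂ) z) (by simpa using hneg)
    rw [h.logOmega_conj hz, Complex.conj_im] at h1
    rw [abs_lt]
    have := Real.pi_pos
    exact ⟨by linarith [h1.2], by linarith [h1.1]⟩
  · have hc : (starRingEnd ℂ) z = z := Complex.conj_eq_iff_im.2 h0
    have h1 := h.logOmega_conj hz
    rw [hc, eq_comm, Complex.conj_eq_iff_im] at h1
    rw [h1, abs_zero]
    exact Real.pi_pos
  · have h1 := h.im_logOmega_mem_of_im_pos hpos
    rw [abs_lt]
    have := Real.pi_pos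
    exact ⟨by linarith [h1.1], h1.2⟩

end Interlaced

/-- The trace formulas of the resolvent of a matrix with eigenvalues `lam`. -/
structure HasTraces (R : Matrix (Fin M) (Fin M) ℂ) (lam : Fin M → ℝ) : Prop where
  trace : ∀ z : ℂ, (∀ k, z ≠ lam k) → (sampleResolvent R z).trace = ∑ k, ((lam k : ℂ) - z)⁻¹
  trace_mul : ∀ z : ℂ, (∀ k, z ≠ lam k) →
    (R * sampleResolvent R z).trace = ∑ k, (lam k : ℂ) * ((lam k : ℂ) - z)⁻¹

namespace Interlaced

variable {R : Matrix (Fin M) (Fin M) ℂ}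

lemma omegaHat_eq (h : Interlaced N lam mu) (hR : HasTraces R lam) {z : ℂ}
    (hz : z ∈ cutPlane lam mu) : omegaHat N R z = Complex.exp (logOmega lam mu z) := by
  rw [omegaHat, h.exp_logOmega hz, hR.trace_mul z fun k => sub_ne_zero.1 (h.sub_lam_ne_zero hz k),
    sub_eq_add_neg, Finset.mul_sum, ← Finset.sum_neg_distrib]
  congr 2
  refine Finset.sum_congr rfl fun k _ => ?_
  rw [← neg_sub z (lam k : ℂ), inv_neg]
  ring

lemma log_omegaHat (h : Interlaced N lam mu) (hR : HasTraces R lam) {z : ℂ}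
    (hz : z ∈ cutPlane lam mu) : Complex.log (omegaHat N R z) = logOmega lam mu z := by
  have := abs_lt.1 (h.abs_im_logOmega_lt hz)
  rw [h.omegaHat_eq hR hz, Complex.log_exp this.1 this.2.le]

lemma deriv_omegaHat (h : Interlaced N lam mu) (hR : HasTraces R lam) {z : ℂ}
    (hz : z ∈ cutPlane lam mu) :
    deriv (omegaHat N R) z = Complex.exp (logOmega lam mu z) * logOmegaDeriv lam mu z := by
  refine HasDerivAt.deriv (((h.hasDerivAt_logOmega hz).cexp).congr_of_eventuallyEq ?_)
  filter_upwards [isOpen_cutPlane.mem_nhds hz] with w hw using h.omegaHat_eq hR hw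

lemma hHat_eq (h : Interlaced N lam mu) (hR : HasTraces R lam) {z : ℂ}
    (hz : z ∈ cutPlane lam mu) (f : ℂ → ℂ) :
    hHat N R f z = f (omegaHat N R z) * (z * logOmegaDeriv lam mu z) := by
  rw [hHat, h.deriv_omegaHat hR hz, h.omegaHat_eq hR hz]
  field_simp [Complex.exp_ne_zero]

end Interlaced

end LogOmega

/-! ### Residues of `log ω̂` against rational functions -/

/-- The sum of the logarithms cut along the intervals `[μₖ, λₖ]`. -/
def cutLog {M : ℕ} (lam mu : Fin M → ℝ) (z : ℂ) : ℂ := ∑ k, logRatio (mu k) (lam k) z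

lemma dslope_inv {x y : ℂ} (hx : x ≠ 0) (hy : y ≠ 0) :
    dslope (fun z : ℂ => z⁻¹) x y = -(x⁻¹ * y⁻¹) := by
  by_cases h : y = x
  · subst h
    rw [dslope_same, (hasDerivAt_inv hx).deriv]
    field_simp
  · have := sub_ne_zero.2 h
    rw [dslope_of_ne _ h, slope_def_field]
    field_simp
    ring

lemma integral_inv_ofReal {a b : ℝ} (ha : 0 < a) (hab : a ≤ b) :
    ∫ x in a..b, ((x : ℂ))⁻¹ = ((Real.log b - Real.log a : ℝ) : ℂ) := by
  have hb := ha.trans_le hab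
  rw [← Real.log_div hb.ne' ha.ne', ← integral_inv_of_pos ha hb, ← intervalIntegral.integral_ofReal]
  simp

lemma integral_one_add_log_mul_inv {a b : ℝ} (ha : 0 < a) (hab : a ≤ b) :
    ∫ x in a..b, (1 + Complex.log x) * (x : ℂ)⁻¹ =
      ((((1 + Real.log b) ^ 2 - (1 + Real.log a) ^ 2) / 2 : ℝ) : ℂ) := by
  have hpos : ∀ x ∈ uIcc a b, 0 < x := fun x hx => by
    rw [uIcc_of_le hab] at hx
    exact ha.trans_le hx.1
  have h1 : ∫ x in a..b, (1 + Real.log x) * x⁻¹ =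
      (1 + Real.log b) ^ 2 / 2 - (1 + Real.log a) ^ 2 / 2 := by
    refine intervalIntegral.integral_eq_sub_of_hasDerivAt
      (f := fun x => (1 + Real.log x) ^ 2 / 2) (fun x hx => ?_) ?_
    · have h := ((((Real.hasDerivAt_log (hpos x hx).ne').const_add 1).pow 2).div_const 2)
      refine h.congr_deriv ?_
      norm_num
      ring
    · apply ContinuousOn.intervalIntegrable
      exact (continuousOn_const.add (Real.continuousOn_log.mono fun x hx => (hpos x hx).ne')).mul
        (continuousOn_inv₀.mono fun x hx => (hpos x hx).ne')
  rw [sub_div, ← h1, ← intervalIntegral.integral_ofReal]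
  refine intervalIntegral.integral_congr fun x hx => ?_
  simp only [Complex.ofReal_mul, Complex.ofReal_add, Complex.ofReal_one, Complex.ofReal_inv,
    Complex.ofReal_log (hpos x hx).le]

lemma integral_dslope_clog {a b w : ℝ} (ha : 0 < a) (hab : a ≤ b) (hw : 0 < w) :
    ∫ x in a..b, dslope Complex.log (w : ℂ) (x : ℂ) =
      ((dilogPrimitive (b / w) - dilogPrimitive (a / w) : ℝ) : ℂ) := by
  rw [← integral_dslope_log ha hab hw, ← intervalIntegral.integral_ofReal]
  refine intervalIntegral.integral_congr fun x hx => ?_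
  rw [uIcc_of_le hab] at hx
  exact dslope_clog_ofReal hw (ha.trans_le hx.1)

lemma differentiableOn_clog : DifferentiableOn ℂ Complex.log Complex.slitPlane := fun _ hz =>
  (Complex.differentiableAt_log hz).differentiableWithinAt

lemma differentiableOn_inv_slitPlane :
    DifferentiableOn ℂ (fun z : ℂ => z⁻¹) Complex.slitPlane := fun _ hz =>
  (differentiableAt_inv (Complex.slitPlane_ne_zero hz)).differentiableWithinAt

/-- The integral `(2πi)⁻¹ ∮ ĥ(z) / (λₖ - z) dz`, for `ĥ` built from `f ∘ log`. -/
def coeffIntegral {M : ℕ} (lam mu : Fin M → ℝ) (γ : Contour) (f : ℂ → ℂ) (k : Fin M) : ℂ :=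
  γ.residue fun z => f (logOmega lam mu z) * (z * logOmegaDeriv lam mu z) * (z - lam k)⁻¹

section Admissible

variable {M N : ℕ} {lam mu : Fin M → ℝ} {γ : Contour}

namespace Contour.IsAdmissible

lemma image_subset (hγ : γ.IsAdmissible lam mu) : γ.image ⊆ Complex.slitPlane := by
  rintro _ ⟨t, ht, rfl⟩
  exact hγ.1 t ht

lemma image_subset_cutPlane (hγ : γ.IsAdmissible lam mu) : γ.image ⊆ cutPlane lam mu :=
  fun _ hz => ⟨hγ.image_subset hz, fun k x hx hzx => (hγ.2 k x hx).notMem_image (hzx ▸ hz)⟩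

lemma encloses_lam (hγ : γ.IsAdmissible lam mu) (h : Interlaced N lam mu) (k : Fin M) :
    γ.Encloses (lam k) := hγ.2 k _ (right_mem_Icc.2 (h.lt k).le)

lemma encloses_mu (hγ : γ.IsAdmissible lam mu) (h : Interlaced N lam mu) (k : Fin M) :
    γ.Encloses (mu k) := hγ.2 k _ (left_mem_Icc.2 (h.lt k).le)

lemma continuousOn_of_differentiableOn (hγ : γ.IsAdmissible lam mu) {g : ℂ → ℂ}
    (hg : DifferentiableOn ℂ g Complex.slitPlane) : ContinuousOn g γ.image :=
  hg.continuousOn.mono hγ.image_subset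

lemma continuousOn_log (hγ : γ.IsAdmissible lam mu) : ContinuousOn Complex.log γ.image :=
  hγ.continuousOn_of_differentiableOn differentiableOn_clog

lemma continuousOn_inv (hγ : γ.IsAdmissible lam mu) : ContinuousOn (fun z : ℂ => z⁻¹) γ.image :=
  hγ.continuousOn_of_differentiableOn differentiableOn_inv_slitPlane

lemma continuousOn_logRatio (hγ : γ.IsAdmissible lam mu) (h : Interlaced N lam mu) (k : Fin M) :
    ContinuousOn (logRatio (mu k) (lam k)) γ.image := fun _ hz =>
  (hasDerivAt_logRatio (h.lt k).le
    ((hγ.image_subset_cutPlane hz).2 k)).continuousAt.continuousWithinAt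

lemma continuousOn_cutLog (hγ : γ.IsAdmissible lam mu) (h : Interlaced N lam mu) :
    ContinuousOn (cutLog lam mu) γ.image :=
  continuousOn_finsetSum _ fun k _ => hγ.continuousOn_logRatio h k

lemma continuousOn_logOmega (hγ : γ.IsAdmissible lam mu) (h : Interlaced N lam mu) :
    ContinuousOn (logOmega lam mu) γ.image := hγ.continuousOn_log.add (hγ.continuousOn_cutLog h)

lemma continuousOn_logOmegaDeriv (hγ : γ.IsAdmissible lam mu) (h : Interlaced N lam mu) :
    ContinuousOn (logOmegaDeriv lam mu) γ.image :=
  hγ.continuousOn_inv.add (continuousOn_finsetSum _ fun k _ =>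
    (hγ.encloses_lam h k).continuousOn_inv_sub.sub (hγ.encloses_mu h k).continuousOn_inv_sub)

lemma residue_cutLog_mul (hγ : γ.IsAdmissible lam mu) (h : Interlaced N lam mu) {g : ℂ → ℂ}
    (hg : ContinuousOn g γ.image) :
    γ.residue (fun z => cutLog lam mu z * g z) =
      -∑ k, ∫ x in (mu k)..(lam k), γ.residue (fun z => g z * (z - (x : ℂ))⁻¹) := by
  simp only [cutLog, Finset.sum_mul]
  rw [Contour.residue_sum _ fun k _ => (hγ.continuousOn_logRatio h k).fun_mul hg,
    ← Finset.sum_neg_distrib]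
  exact Finset.sum_congr rfl fun k _ =>
    Contour.residue_logRatio_mul (h.lt k).le (hγ.2 k) hg

lemma residue_cutLog_mul_of_eq (hγ : γ.IsAdmissible lam mu) (h : Interlaced N lam mu) {g : ℂ → ℂ}
    (hg : ContinuousOn g γ.image) {G : ℝ → ℂ}
    (hG : ∀ x : ℝ, 0 < x → γ.Encloses x → γ.residue (fun z => g z * (z - (x : ℂ))⁻¹) = G x) :
    γ.residue (fun z => cutLog lam mu z * g z) = -∑ k, ∫ x in (mu k)..(lam k), G x := by
  rw [hγ.residue_cutLog_mul h hg]
  congr 1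
  refine Finset.sum_congr rfl fun k _ => intervalIntegral.integral_congr fun x hx => ?_
  rw [uIcc_of_le (h.lt k).le] at hx
  exact hG x ((h.pos k).trans_le hx.1) (hγ.2 k x hx)

lemma residue_cutLog_mul_eq_zero (hγ : γ.IsAdmissible lam mu) (h : Interlaced N lam mu) {g : ℂ → ℂ}
    (hg : ContinuousOn g γ.image)
    (hG : ∀ x : ℝ, γ.Encloses x → γ.residue (fun z => g z * (z - (x : ℂ))⁻¹) = 0) :
    γ.residue (fun z => cutLog lam mu z * g z) = 0 := by
  rw [hγ.residue_cutLog_mul_of_eq h hg (G := fun _ => 0) fun x _ hx => hG x hx]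
  simp

variable {v w : ℝ}

lemma residue_cutLog_mul_inv_sub (hγ : γ.IsAdmissible lam mu) (h : Interlaced N lam mu)
    (hw : γ.Encloses w) : γ.residue (fun z => cutLog lam mu z * (z - w)⁻¹) = 0 :=
  hγ.residue_cutLog_mul_eq_zero h hw.continuousOn_inv_sub fun _ hx =>
    hw.residue_inv_sub_mul_inv_sub hx

lemma residue_cutLog_mul_inv_sub_mul_inv_sub (hγ : γ.IsAdmissible lam mu)
    (h : Interlaced N lam mu) (hv : γ.Encloses v) (hw : γ.Encloses w) :
    γ.residue (fun z => cutLog lam mu z * ((z - v)⁻¹ * (z - w)⁻¹)) = 0 :=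
  hγ.residue_cutLog_mul_eq_zero h (hv.continuousOn_inv_sub.fun_mul hw.continuousOn_inv_sub)
    fun _ hx => hw.residue_inv_sub_mul_inv_sub_mul_inv_sub hx hv

/-- One factor S is opened as an integral of kernels (z - x)⁻¹; the remaining S/((z - w)(z - x))
already has residue 0. -/
lemma residue_cutLog_sq_mul_inv_sub (hγ : γ.IsAdmissible lam mu) (h : Interlaced N lam mu)
    (hw : γ.Encloses w) :
    γ.residue (fun z => cutLog lam mu z * (cutLog lam mu z * (z - w)⁻¹)) = 0 := by
  refine hγ.residue_cutLog_mul_eq_zero h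
    ((hγ.continuousOn_cutLog h).fun_mul hw.continuousOn_inv_sub) fun x hx => ?_
  rw [← hγ.residue_cutLog_mul_inv_sub_mul_inv_sub h hw hx]
  exact Contour.residue_congr fun z _ => mul_assoc _ _ _

/-- The inner residue is the divided difference of log at w and x; integrating it over [μ_k, λ_k] is
where the dilogarithm enters. -/
lemma residue_cutLog_mul_log_mul_inv_sub (hγ : γ.IsAdmissible lam mu) (h : Interlaced N lam mu)
    (hw : γ.Encloses w) (hw0 : 0 < w) :
    γ.residue (fun z => cutLog lam mu z * (Complex.log z * (z - w)⁻¹)) =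
      -((∑ k, (dilogPrimitive (lam k / w) - dilogPrimitive (mu k / w)) : ℝ) : ℂ) := by
  rw [hγ.residue_cutLog_mul_of_eq h (hγ.continuousOn_log.fun_mul hw.continuousOn_inv_sub)
    fun x hx0 hx => hw.residue_mul_inv_sub_mul_inv_sub hx hγ.image_subset
      (ofReal_mem_slitPlane hw0) (ofReal_mem_slitPlane hx0) differentiableOn_clog]
  congr 1
  rw [Complex.ofReal_sum]
  exact Finset.sum_congr rfl fun k _ => integral_dslope_clog (h.pos k) (h.lt k).le hw0

lemma residue_cutLog_mul_one_add_log_mul_inv (hγ : γ.IsAdmissible lam mu)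
    (h : Interlaced N lam mu) :
    γ.residue (fun z => cutLog lam mu z * ((1 + Complex.log z) * z⁻¹)) =
      -((∑ k, ((1 + Real.log (lam k)) ^ 2 - (1 + Real.log (mu k)) ^ 2) / 2 : ℝ) : ℂ) := by
  have hd : DifferentiableOn ℂ (fun z => (1 + Complex.log z) * z⁻¹) Complex.slitPlane :=
    ((differentiableOn_const 1).add differentiableOn_clog).mul differentiableOn_inv_slitPlane
  rw [hγ.residue_cutLog_mul_of_eq h (hγ.continuousOn_of_differentiableOn hd)
    fun x hx0 hx => hx.residue_mul_inv_sub hγ.image_subset (ofReal_mem_slitPlane hx0) hd]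
  congr 1
  rw [Complex.ofReal_sum]
  exact Finset.sum_congr rfl fun k _ => integral_one_add_log_mul_inv (h.pos k) (h.lt k).le

/-- Since the contour stays in the slit plane, z⁻¹ counts as holomorphic; its divided difference is
-(wx)⁻¹, and integrating x⁻¹ gives logarithms. -/
lemma residue_cutLog_mul_inv_mul_inv_sub (hγ : γ.IsAdmissible lam mu) (h : Interlaced N lam mu)
    (hw : γ.Encloses w) (hw0 : 0 < w) :
    γ.residue (fun z => cutLog lam mu z * (z⁻¹ * (z - w)⁻¹)) =
      (w : ℂ)⁻¹ * ((∑ k, (Real.log (lam k) - Real.log (mu k)) : ℝ) : ℂ) := by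
  rw [hγ.residue_cutLog_mul_of_eq h (hγ.continuousOn_inv.fun_mul hw.continuousOn_inv_sub)
    (G := fun x => -((w : ℂ)⁻¹ * (x : ℂ)⁻¹)) fun x hx0 hx => by
      rw [hw.residue_mul_inv_sub_mul_inv_sub hx hγ.image_subset (ofReal_mem_slitPlane hw0)
        (ofReal_mem_slitPlane hx0) differentiableOn_inv_slitPlane, dslope_inv
        (by exact_mod_cast hw0.ne') (by exact_mod_cast hx0.ne')]]
  rw [Complex.ofReal_sum, Finset.mul_sum, ← Finset.sum_neg_distrib]
  refine Finset.sum_congr rfl fun k _ => ?_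
  rw [intervalIntegral.integral_neg, neg_neg, intervalIntegral.integral_const_mul,
    integral_inv_ofReal (h.pos k) (h.lt k).le]

lemma residue_cutLog_sq_mul_inv (hγ : γ.IsAdmissible lam mu) (h : Interlaced N lam mu) :
    γ.residue (fun z => cutLog lam mu z * (cutLog lam mu z * z⁻¹)) =
      -(((∑ k, (Real.log (lam k) - Real.log (mu k))) ^ 2 : ℝ) : ℂ) := by
  set S := ∑ k, (Real.log (lam k) - Real.log (mu k)) with hS
  rw [hγ.residue_cutLog_mul_of_eq h ((hγ.continuousOn_cutLog h).fun_mul hγ.continuousOn_inv)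
    (G := fun x => (x : ℂ)⁻¹ * (S : ℂ)) fun x hx0 hx => by
      rw [← hγ.residue_cutLog_mul_inv_mul_inv_sub h hx hx0]
      exact Contour.residue_congr fun z _ => mul_assoc _ _ _]
  congr 1
  simp only [intervalIntegral.integral_mul_const]
  rw [← Finset.sum_mul, sq, Complex.ofReal_mul]
  congr 1
  rw [hS, Complex.ofReal_sum]
  exact Finset.sum_congr rfl fun k _ => integral_inv_ofReal (h.pos k) (h.lt k).le

end Contour.IsAdmissible

/-- The product formula at z = 0 reads 1 - M/N = ∏ μ_k/λ_k. -/
lemma Interlaced.sum_log_sub_log (h : Interlaced N lam mu) :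
    ∑ k, (Real.log (lam k) - Real.log (mu k)) = -Real.log (1 - (M : ℝ) / N) := by
  have h1 := one_add_sum_eq_prod_div lam (fun j => lam j / N) mu h.strictMono_mu.injective
    h.mu_ne_lam h.one_add_sum_eq_zero (z := 0) fun k => (h.lam_pos k).ne
  have hl : ∀ j, lam j / N * (0 - lam j)⁻¹ = -(1 / N) := fun j => by
    have := (h.lam_pos j).ne'
    have := h.N_pos.ne'
    rw [zero_sub, inv_neg]
    field_simp
  have hr : ∀ k, (0 - mu k) / (0 - lam k) = mu k / lam k := fun k => by
    rw [zero_sub, zero_sub, neg_div_neg_eq]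
  simp only [hl, hr, Finset.sum_const, Finset.card_univ, Fintype.card_fin, nsmul_eq_mul] at h1
  have h2 : 1 - (M : ℝ) / N = ∏ k, mu k / lam k := by rw [← h1]; ring
  rw [h2, Real.log_prod fun k _ => (div_pos (h.pos k) (h.lam_pos k)).ne', ← Finset.sum_neg_distrib]
  refine Finset.sum_congr rfl fun k _ => ?_
  rw [Real.log_div (h.pos k).ne' (h.lam_pos k).ne', neg_sub]

end Admissible

section Alpha

variable {M N : ℕ} {lam mu : Fin M → ℝ} {γ : Contour}

/-! ### The coefficient of `log²` -/

namespace Contour.IsAdmissible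

lemma residue_one_add_logOmega_sq_mul_inv (hγ : γ.IsAdmissible lam mu) (h : Interlaced N lam mu) :
    γ.residue (fun z => ((1 + logOmega lam mu z) ^ 2 + 1) * z⁻¹) =
      ((∑ k, ((1 + Real.log (mu k)) ^ 2 - (1 + Real.log (lam k)) ^ 2)
        - Real.log (1 - (M : ℝ) / N) ^ 2 : ℝ) : ℂ) := by
  have hd : DifferentiableOn ℂ (fun z => ((1 + Complex.log z) ^ 2 + 1) * z⁻¹) Complex.slitPlane :=
    ((((differentiableOn_const 1).add differentiableOn_clog).pow 2).add
      (differentiableOn_const 1)).mul differentiableOn_inv_slitPlane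
  have hS := hγ.continuousOn_cutLog h
  have hl := continuousOn_const (c := (1 : ℂ)).fun_add hγ.continuousOn_log
  have hi := hγ.continuousOn_inv
  have h1 : EqOn (fun z => ((1 + logOmega lam mu z) ^ 2 + 1) * z⁻¹)
      (fun z => (((1 + Complex.log z) ^ 2 + 1) * z⁻¹ +
        2 * (cutLog lam mu z * ((1 + Complex.log z) * z⁻¹))) +
        cutLog lam mu z * (cutLog lam mu z * z⁻¹)) γ.image := fun z _ => by
    simp only [logOmega, cutLog]
    ring
  have c1 := hγ.continuousOn_of_differentiableOn hd
  have c2 := continuousOn_const (c := (2 : ℂ)).fun_mul (hS.fun_mul (hl.fun_mul hi))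
  rw [Contour.residue_congr h1, Contour.residue_add (c1.fun_add c2) (hS.fun_mul (hS.fun_mul hi)),
    Contour.residue_add c1 c2, Contour.residue_const_mul,
    Contour.residue_eq_zero_of_differentiableOn hγ.image_subset hd,
    hγ.residue_cutLog_mul_one_add_log_mul_inv h, hγ.residue_cutLog_sq_mul_inv h,
    h.sum_log_sub_log, ← Finset.sum_div]
  have h2 : ∑ k, ((1 + Real.log (mu k)) ^ 2 - (1 + Real.log (lam k)) ^ 2) =
      -∑ k, ((1 + Real.log (lam k)) ^ 2 - (1 + Real.log (mu k)) ^ 2) := by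
    rw [← Finset.sum_neg_distrib]
    exact Finset.sum_congr rfl fun k _ => by ring
  rw [h2]
  push_cast
  ring

lemma residue_one_add_logOmega_sq_mul_inv_sub (hγ : γ.IsAdmissible lam mu)
    (h : Interlaced N lam mu) {w : ℝ} (hw : γ.Encloses w) (hw0 : 0 < w) :
    γ.residue (fun z => ((1 + logOmega lam mu z) ^ 2 + 1) * (z - w)⁻¹) =
      (((1 + Real.log w) ^ 2 + 1
        - 2 * ∑ k, (dilogPrimitive (lam k / w) - dilogPrimitive (mu k / w)) : ℝ) : ℂ) := by
  have hd : DifferentiableOn ℂ (fun z => (1 + Complex.log z) ^ 2 + 1) Complex.slitPlane :=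
    (((differentiableOn_const 1).add differentiableOn_clog).pow 2).add (differentiableOn_const 1)
  have hS := hγ.continuousOn_cutLog h
  have hi := hw.continuousOn_inv_sub
  have h1 : EqOn (fun z => ((1 + logOmega lam mu z) ^ 2 + 1) * (z - w)⁻¹)
      (fun z => ((((1 + Complex.log z) ^ 2 + 1) * (z - w)⁻¹ +
        2 * (cutLog lam mu z * (z - w)⁻¹)) +
        2 * (cutLog lam mu z * (Complex.log z * (z - w)⁻¹))) +
        cutLog lam mu z * (cutLog lam mu z * (z - w)⁻¹)) γ.image := fun z _ => by
    simp only [logOmega, cutLog]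
    ring
  have c1 := (hγ.continuousOn_of_differentiableOn hd).fun_mul hi
  have c2 := continuousOn_const (c := (2 : ℂ)).fun_mul (hS.fun_mul hi)
  have c3 := continuousOn_const (c := (2 : ℂ)).fun_mul (hS.fun_mul (hγ.continuousOn_log.fun_mul hi))
  rw [Contour.residue_congr h1, Contour.residue_add ((c1.fun_add c2).fun_add c3)
    (hS.fun_mul (hS.fun_mul hi)), Contour.residue_add (c1.fun_add c2) c3,
    Contour.residue_add c1 c2, Contour.residue_const_mul, Contour.residue_const_mul,
    hw.residue_mul_inv_sub hγ.image_subset (ofReal_mem_slitPlane hw0) hd,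
    hγ.residue_cutLog_mul_inv_sub h hw, hγ.residue_cutLog_mul_log_mul_inv_sub h hw hw0,
    hγ.residue_cutLog_sq_mul_inv_sub h hw, ← Complex.ofReal_log hw0.le]
  push_cast
  ring

/-- With ∑ (z - λ_k)⁻¹ = N exp(-L) - (N - M)/z, the summed integrand is N z exp(-L) L² L' - (N - M)
L² L'. The second term is exact. In the first, exp(-L) L² L' is minus the derivative of exp(-L)(L² +
2L + 2); integrating by parts leaves N exp(-L)((1 + L)² + 1), and exp(-L) is expanded again. -/
lemma sum_coeffIntegral_sq_eq (hγ : γ.IsAdmissible lam mu) (h : Interlaced N lam mu) :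
    ∑ k, coeffIntegral lam mu γ (fun l => l ^ 2) k =
      ((N : ℂ) - M) * γ.residue (fun z => ((1 + logOmega lam mu z) ^ 2 + 1) * z⁻¹) +
        ∑ k, γ.residue (fun z => ((1 + logOmega lam mu z) ^ 2 + 1) * (z - lam k)⁻¹) := by
  have hN : (N : ℂ) ≠ 0 := by exact_mod_cast h.N_pos.ne'
  have cL := hγ.continuousOn_logOmega h
  have cD := hγ.continuousOn_logOmegaDeriv h
  have cl : ∀ k, ContinuousOn (fun z : ℂ => (z - lam k)⁻¹) γ.image :=
    fun k => (hγ.encloses_lam h k).continuousOn_inv_sub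
  have cP : ContinuousOn (fun z => (1 + logOmega lam mu z) ^ 2 + 1) γ.image :=
    ((continuousOn_const.add cL).pow 2).add continuousOn_const
  -- The primitive collecting the exact term and the boundary term of the integration by parts.
  let F : ℂ → ℂ := fun z => ((N : ℂ) - M) / 3 * logOmega lam mu z ^ 3 +
    N * (z * Complex.exp (-logOmega lam mu z)) *
      (logOmega lam mu z ^ 2 + 2 * logOmega lam mu z + 2)
  let F' : ℂ → ℂ := fun z => ((N : ℂ) - M) * logOmega lam mu z ^ 2 * logOmegaDeriv lam mu z +
    N * Complex.exp (-logOmega lam mu z) * ((1 + logOmega lam mu z) ^ 2 + 1) -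
    N * z * Complex.exp (-logOmega lam mu z) * logOmega lam mu z ^ 2 * logOmegaDeriv lam mu z
  have hF : ∀ z ∈ γ.image, HasDerivAt F (F' z) z := by
    intro z hz
    have hL := h.hasDerivAt_logOmega (hγ.image_subset_cutPlane hz)
    have hd := ((hL.pow 3).const_mul (((N : ℂ) - M) / 3)).add
      ((((hasDerivAt_id z).mul hL.neg.cexp).const_mul (N : ℂ)).mul
        (((hL.pow 2).add (hL.const_mul 2)).add_const 2))
    refine hd.congr_deriv ?_
    simp only [F', id, Pi.mul_apply, Pi.add_apply, Pi.pow_apply, Pi.neg_apply]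
    push_cast
    ring
  have cF' : ContinuousOn F' γ.image := by
    have cE := cL.neg.cexp
    exact (((continuousOn_const.mul (cL.pow 2)).mul cD).add ((continuousOn_const.mul cE).mul cP)).sub
      ((((continuousOn_const.mul continuousOn_id).mul cE).mul (cL.pow 2)).mul cD)
  have key : EqOn (fun z => ∑ k, logOmega lam mu z ^ 2 * (z * logOmegaDeriv lam mu z) *
        (z - lam k)⁻¹)
      (fun z => (((N : ℂ) - M) * (((1 + logOmega lam mu z) ^ 2 + 1) * z⁻¹) +
        ∑ k, ((1 + logOmega lam mu z) ^ 2 + 1) * (z - lam k)⁻¹) - F' z) γ.image := by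
    intro z hz
    have hzc := hγ.image_subset_cutPlane hz
    have hz0 : z ≠ 0 := Complex.slitPlane_ne_zero hzc.1
    simp only [F', h.exp_neg_logOmega hzc, ← Finset.mul_sum]
    field_simp
    ring
  have cD1 := continuousOn_const (c := (N : ℂ) - M).fun_mul (cP.fun_mul hγ.continuousOn_inv)
  have cD2 : ∀ k ∈ Finset.univ, ContinuousOn (fun z : ℂ => ((1 + logOmega lam mu z) ^ 2 + 1) *
      (z - lam k)⁻¹) γ.image := fun k _ => cP.fun_mul (cl k)
  have cD3 := continuousOn_finsetSum _ cD2
  have cD4 : ∀ k ∈ Finset.univ, ContinuousOn (fun z : ℂ => logOmega lam mu z ^ 2 *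
      (z * logOmegaDeriv lam mu z) * (z - lam k)⁻¹) γ.image :=
    fun k _ => ((cL.pow 2).mul (continuousOn_id.mul cD)).mul (cl k)
  simp only [coeffIntegral]
  rw [← Contour.residue_sum _ cD4,
    ← sub_zero (((N : ℂ) - M) * _ + _), ← Contour.residue_eq_zero_of_hasDerivAt hF cF',
    ← Contour.residue_const_mul, ← Contour.residue_sum _ cD2, ← Contour.residue_add cD1 cD3,
    ← Contour.residue_sub (cD1.fun_add cD3) cF']
  exact Contour.residue_congr key

end Contour.IsAdmissible

lemma log_mul_log_div_abs {x w : ℝ} (hw : 0 < w) :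
    Real.log (x / w) * Real.log (1 - x / w) =
      -(Real.log (x / w) * Real.log (w / |w - x|)) := by
  by_cases hxw : x = w
  · simp [hxw, div_self hw.ne']
  · have h0 : w - x ≠ 0 := sub_ne_zero.2 (Ne.symm hxw)
    have h1 : 1 - x / w = (w - x) / w := by field_simp
    rw [h1, Real.log_div h0 hw.ne', Real.log_div hw.ne' (abs_ne_zero.2 h0), Real.log_abs]
    ring

lemma Interlaced.alphaClosed_eq (h : Interlaced N lam mu) (hM : 0 < M) :
    (M : ℝ) * alphaClosed N lam mu =
      ((N : ℝ) - M) * (∑ k, ((1 + Real.log (mu k)) ^ 2 - (1 + Real.log (lam k)) ^ 2)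
        - Real.log (1 - (M : ℝ) / N) ^ 2) +
      ∑ k, ((1 + Real.log (lam k)) ^ 2 + 1
        - 2 * ∑ r, (dilogPrimitive (lam r / lam k) - dilogPrimitive (mu r / lam k))) := by
  have hM0 : (M : ℝ) ≠ 0 := by exact_mod_cast hM.ne'
  have hsum : ∀ k, ∑ r, (dilogPrimitive (lam r / lam k) - dilogPrimitive (mu r / lam k)) =
      -(∑ r, (Phi2 (mu r / lam k) - Phi2 (lam r / lam k)))
      - ((∑ r with r ≠ k, Real.log (lam r / lam k) * Real.log (lam k / |lam k - lam r|))
        - ∑ r, Real.log (mu r / lam k) * Real.log (lam k / |lam k - mu r|)) := by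
    intro k
    -- The term r = k may be restored because its first factor is log 1 = 0.
    have h1 : ∑ r with r ≠ k, Real.log (lam r / lam k) * Real.log (lam k / |lam k - lam r|) =
        ∑ r, Real.log (lam r / lam k) * Real.log (lam k / |lam k - lam r|) := by
      rw [Finset.sum_filter]
      refine Finset.sum_congr rfl fun r _ => ?_
      split_ifs with hr
      · rfl
      · rw [not_not.1 hr]; simp
    rw [h1, ← Finset.sum_sub_distrib, ← Finset.sum_neg_distrib, ← Finset.sum_sub_distrib]
    refine Finset.sum_congr rfl fun r _ => ?_
    rw [dilogPrimitive, dilogPrimitive, log_mul_log_div_abs (h.lam_pos k),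
      log_mul_log_div_abs (h.lam_pos k)]
    ring
  simp only [hsum]
  simp only [Finset.sum_sub_distrib, Finset.sum_add_distrib, ← Finset.mul_sum,
    Finset.sum_neg_distrib, Finset.sum_const, Finset.card_univ, Fintype.card_fin, nsmul_eq_mul,
    alphaClosed]
  field_simp
  ring

lemma Contour.IsAdmissible.sum_coeffIntegral_sq (hγ : γ.IsAdmissible lam mu)
    (h : Interlaced N lam mu) (hM : 0 < M) :
    ∑ k, coeffIntegral lam mu γ (fun l => l ^ 2) k = ((M * alphaClosed N lam mu : ℝ) : ℂ) := by
  rw [hγ.sum_coeffIntegral_sq_eq h, h.alphaClosed_eq hM, hγ.residue_one_add_logOmega_sq_mul_inv h]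
  simp only [fun k => hγ.residue_one_add_logOmega_sq_mul_inv_sub h (hγ.encloses_lam h k)
    (h.lam_pos k)]
  push_cast
  rfl

end Alpha

/-! ### The coefficients of `1` and of `log` -/

section Beta

variable {M N : ℕ} {lam mu : Fin M → ℝ} {γ : Contour}

namespace Contour.IsAdmissible

/-- From z/(z - λ) - z/(z - μ) = λ/(z - λ) - μ/(z - μ), the factor z cancels and only products of
Cauchy kernels remain. -/
lemma residue_mul_logOmegaDeriv (hγ : γ.IsAdmissible lam mu) (h : Interlaced N lam mu)
    {g : ℂ → ℂ} (hg : ContinuousOn g γ.image) (k : Fin M) :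
    γ.residue (fun z => g z * (z * logOmegaDeriv lam mu z) * (z - lam k)⁻¹) =
      γ.residue (fun z => g z * (z - lam k)⁻¹) +
        ∑ r, (lam r * γ.residue (fun z => g z * (z - lam r)⁻¹ * (z - lam k)⁻¹) -
          mu r * γ.residue (fun z => g z * (z - mu r)⁻¹ * (z - lam k)⁻¹)) := by
  have cl : ∀ k, ContinuousOn (fun z : ℂ => (z - lam k)⁻¹) γ.image :=
    fun k => (hγ.encloses_lam h k).continuousOn_inv_sub
  have cm : ∀ k, ContinuousOn (fun z : ℂ => (z - mu k)⁻¹) γ.image :=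
    fun k => (hγ.encloses_mu h k).continuousOn_inv_sub
  have c1 : ∀ r, ContinuousOn (fun z => (lam r : ℂ) * (g z * (z - lam r)⁻¹ * (z - lam k)⁻¹))
      γ.image := fun r => continuousOn_const.mul ((hg.mul (cl r)).mul (cl k))
  have c2 : ∀ r, ContinuousOn (fun z => (mu r : ℂ) * (g z * (z - mu r)⁻¹ * (z - lam k)⁻¹))
      γ.image := fun r => continuousOn_const.mul ((hg.mul (cm r)).mul (cl k))
  have c3 : ∀ r ∈ Finset.univ, ContinuousOn
      (fun z => (lam r : ℂ) * (g z * (z - lam r)⁻¹ * (z - lam k)⁻¹) -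
        (mu r : ℂ) * (g z * (z - mu r)⁻¹ * (z - lam k)⁻¹)) γ.image :=
    fun r _ => (c1 r).fun_sub (c2 r)
  simp only [← Contour.residue_const_mul]
  simp only [← Contour.residue_sub (c1 _) (c2 _)]
  rw [← Contour.residue_sum _ c3, ← Contour.residue_add (hg.fun_mul (cl k))
    (continuousOn_finsetSum _ c3)]
  refine Contour.residue_congr fun z hz => ?_
  have hzc := hγ.image_subset_cutPlane hz
  have hz0 : z ≠ 0 := Complex.slitPlane_ne_zero hzc.1
  have h1 : ∀ r, (lam r : ℂ) * (g z * (z - lam r)⁻¹ * (z - lam k)⁻¹) -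
        (mu r : ℂ) * (g z * (z - mu r)⁻¹ * (z - lam k)⁻¹) =
      g z * (z - lam k)⁻¹ * (z * ((z - lam r)⁻¹ - (z - mu r)⁻¹)) := by
    intro r
    have hl := h.sub_lam_ne_zero hzc r
    have hm := h.sub_mu_ne_zero hzc r
    field_simp
    ring
  simp only [h1, logOmegaDeriv, ← Finset.mul_sum]
  field_simp

lemma coeffIntegral_one (hγ : γ.IsAdmissible lam mu) (h : Interlaced N lam mu) (k : Fin M) :
    coeffIntegral lam mu γ (fun _ => 1) k = 1 := by
  have hl := hγ.encloses_lam h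
  have hm := hγ.encloses_mu h
  rw [coeffIntegral, hγ.residue_mul_logOmegaDeriv h (g := fun _ => 1) continuousOn_const]
  simp only [one_mul, (hl _).residue_inv_sub_mul_inv_sub (hl k),
    (hm _).residue_inv_sub_mul_inv_sub (hl k), (hl k).residue_inv_sub]
  simp

/-- The cut part S of L contributes nothing against one or two Cauchy kernels, so L may be replaced
by log z; the term r = k is a derivative, contained in `dslope`. -/
lemma coeffIntegral_id_eq (hγ : γ.IsAdmissible lam mu) (h : Interlaced N lam mu) (k : Fin M) :
    coeffIntegral lam mu γ (fun l => l) k =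
      ((Real.log (lam k) + ∑ r, (lam r * dslope Real.log (lam r) (lam k) -
        mu r * dslope Real.log (mu r) (lam k)) : ℝ) : ℂ) := by
  have hl := hγ.encloses_lam h
  have hm := hγ.encloses_mu h
  have cl := fun k => (hl k).continuousOn_inv_sub
  have sl : ∀ k, (lam k : ℂ) ∈ Complex.slitPlane := fun k => ofReal_mem_slitPlane (h.lam_pos k)
  have cS := hγ.continuousOn_cutLog h
  have cL := hγ.continuousOn_log
  have e1 : γ.residue (fun z => logOmega lam mu z * (z - lam k)⁻¹) = Complex.log (lam k) := by
    rw [Contour.residue_congr (g := fun z => Complex.log z * (z - lam k)⁻¹ +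
      cutLog lam mu z * (z - lam k)⁻¹) fun z _ => by simp only [logOmega, cutLog]; ring,
      Contour.residue_add (cL.fun_mul (cl k)) (cS.fun_mul (cl k)),
      hγ.residue_cutLog_mul_inv_sub h (hl k),
      (hl k).residue_mul_inv_sub hγ.image_subset (sl k) differentiableOn_clog, add_zero]
  have e2 : ∀ a : ℝ, 0 < a → γ.Encloses a →
      γ.residue (fun z => logOmega lam mu z * (z - a)⁻¹ * (z - lam k)⁻¹) =
        (dslope Real.log a (lam k) : ℝ) := by
    intro a ha0 ha
    rw [Contour.residue_congr (g := fun z => Complex.log z * (z - a)⁻¹ * (z - lam k)⁻¹ +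
      cutLog lam mu z * ((z - a)⁻¹ * (z - lam k)⁻¹)) fun z _ => by
        simp only [logOmega, cutLog]; ring,
      Contour.residue_add ((cL.fun_mul ha.continuousOn_inv_sub).fun_mul (cl k))
        (cS.fun_mul (ha.continuousOn_inv_sub.fun_mul (cl k))),
      hγ.residue_cutLog_mul_inv_sub_mul_inv_sub h ha (hl k),
      ha.residue_mul_inv_sub_mul_inv_sub (hl k) hγ.image_subset (ofReal_mem_slitPlane ha0) (sl k)
        differentiableOn_clog, add_zero, dslope_clog_ofReal ha0 (h.lam_pos k)]
  rw [coeffIntegral, hγ.residue_mul_logOmegaDeriv h (hγ.continuousOn_logOmega h), e1]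
  simp only [fun r => e2 _ (h.lam_pos r) (hl r), fun r => e2 _ (h.pos r) (hm r)]
  push_cast [Complex.ofReal_log (h.lam_pos k).le]
  rfl

end Contour.IsAdmissible

/-- The secular equation at μ_k, with λ/(λ - μ) = 1 + μ/(λ - μ). -/
lemma Interlaced.sum_mu_div (h : Interlaced N lam mu) (k : Fin M) :
    ∑ m, mu k / (lam m - mu k) = (N : ℝ) - M := by
  have h1 := h.secular_eq k
  have h2 : ∀ m, lam m / (lam m - mu k) = 1 + mu k / (lam m - mu k) := fun m => by
    have := sub_ne_zero.2 (h.mu_ne_lam k m).symm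
    field_simp
    ring
  simp only [secular, h2, Finset.sum_add_distrib, Finset.sum_const, Finset.card_univ,
    Fintype.card_fin, nsmul_eq_mul, mul_one] at h1
  have := h.N_pos.ne'
  field_simp at h1
  linarith

/-- Multiplying the product formula by x - λ_k removes the pole at λ_k; the logarithmic derivatives
of the two sides at λ_k are then compared. Signs of factors do not matter since `Real.log` is
log|·|. -/
lemma Interlaced.log_derivative_eq (h : Interlaced N lam mu) (k : Fin M) :
    (1 + ∑ j ∈ Finset.univ.erase k, lam j / N * (lam k - lam j)⁻¹) / (lam k / N) =
      ∑ m, (lam k - mu m)⁻¹ - ∑ m ∈ Finset.univ.erase k, (lam k - lam m)⁻¹ := by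
  have hN := h.N_pos
  have hne : ∀ j ∈ Finset.univ.erase k, lam k - lam j ≠ 0 := fun j hj =>
    sub_ne_zero.2 (h.strictMono_lam.injective.ne (Finset.ne_of_mem_erase hj).symm)
  have hnm : ∀ m, lam k - mu m ≠ 0 := fun m => sub_ne_zero.2 (h.mu_ne_lam m k).symm
  set f : ℝ → ℝ := fun x =>
    (x - lam k) * (1 + ∑ j ∈ Finset.univ.erase k, lam j / N * (x - lam j)⁻¹) + lam k / N with hf
  have hfk : f (lam k) = lam k / N := by simp [hf]
  have hfd : HasDerivAt f (1 + ∑ j ∈ Finset.univ.erase k, lam j / N * (lam k - lam j)⁻¹) (lam k) := by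
    have h1 : HasDerivAt (fun x => 1 + ∑ j ∈ Finset.univ.erase k, lam j / N * (x - lam j)⁻¹)
        (∑ j ∈ Finset.univ.erase k, lam j / N * (-1 / (lam k - lam j) ^ 2)) (lam k) :=
      (HasDerivAt.fun_sum fun j hj =>
        (((hasDerivAt_id (lam k)).sub_const (lam j)).fun_inv (hne j hj)).const_mul
          (lam j / N)).const_add 1
    refine ((((hasDerivAt_id _).sub_const (lam k)).mul h1).add_const (lam k / N)).congr_deriv ?_
    simp
  have hlog : ∀ᶠ x in 𝓝 (lam k), Real.log (f x) =
      ∑ m, Real.log (x - mu m) - ∑ m ∈ Finset.univ.erase k, Real.log (x - lam m) := by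
    have ev1 : ∀ᶠ x in 𝓝 (lam k), ∀ j ∈ Finset.univ.erase k, x - lam j ≠ 0 :=
      (Filter.eventually_all_finset _).2 fun j hj =>
        (continuousAt_id.sub continuousAt_const).eventually_ne (hne j hj)
    have ev2 : ∀ᶠ x in 𝓝 (lam k), ∀ m, x - mu m ≠ 0 :=
      Filter.eventually_all.2 fun m =>
        (continuousAt_id.sub continuousAt_const).eventually_ne (hnm m)
    filter_upwards [ev1, ev2] with x h1 h2
    have hroot : ∀ r, ∏ m, (mu r - lam m) +
        ∑ j, lam j / N * ∏ m ∈ Finset.univ.erase j, (mu r - lam m) = 0 := fun r => by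
      rw [← prod_mul_one_add_sum lam (fun j => lam j / N) (h.mu_ne_lam r), h.one_add_sum_eq_zero,
        mul_zero]
    have hp := prod_sub_add_sum_eq_prod_sub lam (fun j => lam j / N) mu
      h.strictMono_mu.injective hroot x
    have hA : ∏ m ∈ Finset.univ.erase k, (x - lam m) ≠ 0 := Finset.prod_ne_zero_iff.2 h1
    have hfx : ∏ m, (x - mu m) = f x * ∏ m ∈ Finset.univ.erase k, (x - lam m) := by
      rw [← hp, ← Finset.mul_prod_erase _ _ (Finset.mem_univ k),
        ← Finset.add_sum_erase _ _ (Finset.mem_univ k), hf]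
      have h3 : ∑ j ∈ Finset.univ.erase k, lam j / N * ∏ m ∈ Finset.univ.erase j, (x - lam m) =
          (x - lam k) * (∑ j ∈ Finset.univ.erase k, lam j / N * (x - lam j)⁻¹) *
            ∏ m ∈ Finset.univ.erase k, (x - lam m) := by
        rw [Finset.mul_sum, Finset.sum_mul]
        refine Finset.sum_congr rfl fun j hj => ?_
        have hjk := Finset.ne_of_mem_erase hj
        have hj0 := h1 j hj
        rw [← Finset.mul_prod_erase (Finset.univ.erase j) _
            (Finset.mem_erase.2 ⟨hjk.symm, Finset.mem_univ k⟩),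
          ← Finset.mul_prod_erase (Finset.univ.erase k) _ hj, Finset.erase_right_comm]
        field_simp
      rw [h3]
      ring
    have hfx0 : f x ≠ 0 := fun h0 => by
      rw [h0, zero_mul] at hfx
      exact Finset.prod_ne_zero_iff.2 (fun m _ => h2 m) hfx
    rw [← Real.log_prod fun m _ => h2 m, hfx, Real.log_mul hfx0 hA, Real.log_prod h1]
    ring
  have hd1 := hfd.log (by rw [hfk]; exact (div_pos (h.lam_pos k) hN).ne')
  have hd2 : HasDerivAt (fun x => ∑ m, Real.log (x - mu m) -
      ∑ m ∈ Finset.univ.erase k, Real.log (x - lam m))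
      (∑ m, (lam k - mu m)⁻¹ - ∑ m ∈ Finset.univ.erase k, (lam k - lam m)⁻¹) (lam k) := by
    refine (HasDerivAt.fun_sum fun m _ => ?_).sub (HasDerivAt.fun_sum fun m hm => ?_)
    · simpa using ((hasDerivAt_id (lam k)).sub_const (mu m)).log (hnm m)
    · simpa using ((hasDerivAt_id (lam k)).sub_const (lam m)).log (hne m hm)
  rw [hfk] at hd1
  exact hd1.unique (hd2.congr_of_eventuallyEq hlog)

lemma Interlaced.sum_lam_div_sub_sum_mu_div (h : Interlaced N lam mu) (k : Fin M) :
    ∑ j ∈ Finset.univ.erase k, lam j / (lam k - lam j) - ∑ m, mu m / (lam k - mu m) =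
      ∑ m ∈ Finset.univ.erase k, lam k / (lam m - lam k) - ((N : ℝ) - M) := by
  have hN := h.N_pos.ne'
  have hk := (h.lam_pos k).ne'
  have h1 := h.log_derivative_eq k
  have e1 : (1 + ∑ j ∈ Finset.univ.erase k, lam j / N * (lam k - lam j)⁻¹) / (lam k / N) =
      (N + ∑ j ∈ Finset.univ.erase k, lam j / (lam k - lam j)) / lam k := by
    have : ∑ j ∈ Finset.univ.erase k, lam j / N * (lam k - lam j)⁻¹ =
        (∑ j ∈ Finset.univ.erase k, lam j / (lam k - lam j)) / N := by
      rw [Finset.sum_div]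
      exact Finset.sum_congr rfl fun j _ => by ring
    rw [this]
    field_simp
  have e2 : ∑ m, mu m / (lam k - mu m) = lam k * ∑ m, (lam k - mu m)⁻¹ - M := by
    have : ∀ m, mu m / (lam k - mu m) = lam k * (lam k - mu m)⁻¹ - 1 := fun m => by
      have := sub_ne_zero.2 (h.mu_ne_lam m k).symm
      field_simp
      ring
    simp [this, Finset.mul_sum]
  have e3 : ∑ m ∈ Finset.univ.erase k, lam k / (lam m - lam k) =
      -(lam k * ∑ m ∈ Finset.univ.erase k, (lam k - lam m)⁻¹) := by
    rw [Finset.mul_sum, ← Finset.sum_neg_distrib]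
    refine Finset.sum_congr rfl fun m _ => ?_
    rw [← neg_sub (lam k) (lam m), div_neg, div_eq_mul_inv]
  rw [e1, div_eq_iff hk] at h1
  rw [e2, e3]
  linarith

/-- The term r = k supplies the constant 1, as λ_k times the derivative of log at λ_k. The two forms
then differ only in the coefficient of log λ_k, and the preceding identities match it. -/
lemma Interlaced.betaCoeff_eq (h : Interlaced N lam mu) (k : Fin M) :
    betaCoeff lam mu k = Real.log (lam k) + ∑ r, (lam r * dslope Real.log (lam r) (lam k) -
      mu r * dslope Real.log (mu r) (lam k)) := by
  have hfilter : (Finset.univ.filter fun m => m ≠ k) = Finset.univ.erase k := by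
    ext m; simp
  have e1 : ∑ r, lam r * dslope Real.log (lam r) (lam k) =
      1 + (Real.log (lam k) * ∑ r ∈ Finset.univ.erase k, lam r / (lam k - lam r) +
        ∑ r ∈ Finset.univ.erase k, lam r / (lam r - lam k) * Real.log (lam r)) := by
    rw [← Finset.add_sum_erase _ _ (Finset.mem_univ k), dslope_same, Real.deriv_log,
      mul_inv_cancel₀ (h.lam_pos k).ne', Finset.mul_sum, ← Finset.sum_add_distrib]
    congr 1
    refine Finset.sum_congr rfl fun r hr => ?_
    have hne := h.strictMono_lam.injective.ne (Finset.ne_of_mem_erase hr).symm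
    rw [dslope_of_ne _ hne, slope_def_field, ← neg_sub (lam k) (lam r), div_neg]
    ring
  have e2 : ∑ r, mu r * dslope Real.log (mu r) (lam k) =
      Real.log (lam k) * ∑ r, mu r / (lam k - mu r) +
        ∑ r, mu r / (mu r - lam k) * Real.log (mu r) := by
    rw [Finset.mul_sum, ← Finset.sum_add_distrib]
    refine Finset.sum_congr rfl fun r _ => ?_
    rw [dslope_of_ne _ (h.mu_ne_lam r k).symm, slope_def_field, ← neg_sub (lam k) (mu r), div_neg]
    ring
  rw [betaCoeff, hfilter, h.sum_mu_div k, Finset.sum_sub_distrib, e1, e2]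
  linear_combination -(Real.log (lam k)) * h.sum_lam_div_sub_sum_mu_div k

lemma Contour.IsAdmissible.coeffIntegral_id (hγ : γ.IsAdmissible lam mu)
    (h : Interlaced N lam mu) (k : Fin M) :
    coeffIntegral lam mu γ (fun l => l) k = (betaCoeff lam mu k : ℂ) := by
  rw [hγ.coeffIntegral_id_eq h, h.betaCoeff_eq]

end Beta

/-! ### The resolvent in an eigenbasis -/

section Eigenbasis

variable {M : ℕ} {A : Matrix (Fin M) (Fin M) ℂ} {lam : Fin M → ℝ} {e : Fin M → Fin M → ℂ}

/-- The matrix whose columns are the given vectors. -/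
def colMatrix (e : Fin M → Fin M → ℂ) : Matrix (Fin M) (Fin M) ℂ := Matrix.of fun i k => e k i

lemma conjTranspose_colMatrix_mul_apply (e e' : Fin M → Fin M → ℂ) (k m : Fin M) :
    ((colMatrix e)ᴴ * colMatrix e') k m = star (e k) ⬝ᵥ e' m := rfl

namespace IsEigendecomposition

lemma conjTranspose_mul (h : IsEigendecomposition A lam e) :
    (colMatrix e)ᴴ * colMatrix e = 1 := by
  ext k m
  rw [conjTranspose_colMatrix_mul_apply, h.orthonormal, Matrix.one_apply]

lemma mul_conjTranspose (h : IsEigendecomposition A lam e) :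
    colMatrix e * (colMatrix e)ᴴ = 1 := mul_eq_one_comm.1 h.conjTranspose_mul

lemma mul_colMatrix (h : IsEigendecomposition A lam e) :
    A * colMatrix e = colMatrix e * Matrix.diagonal fun k => (lam k : ℂ) := by
  ext i k
  rw [Matrix.mul_diagonal]
  have := congrFun (h.eigen k) i
  rw [Pi.smul_apply, smul_eq_mul, mul_comm] at this
  exact this

lemma sampleResolvent_eq (h : IsEigendecomposition A lam e) {z : ℂ} (hz : ∀ k, z ≠ lam k) :
    sampleResolvent A z =
      colMatrix e * Matrix.diagonal (fun k => ((lam k : ℂ) - z)⁻¹) * (colMatrix e)ᴴ := by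
  have hd : (Matrix.diagonal fun k => (lam k : ℂ)) - z • (1 : Matrix (Fin M) (Fin M) ℂ) =
      Matrix.diagonal fun k => (lam k : ℂ) - z := by
    ext i j
    by_cases hij : i = j
    · subst hij; simp
    · simp [hij]
  refine Matrix.inv_eq_right_inv ?_
  have h1 : (A - z • (1 : Matrix (Fin M) (Fin M) ℂ)) * colMatrix e =
      colMatrix e * Matrix.diagonal fun k => (lam k : ℂ) - z := by
    rw [sub_mul, h.mul_colMatrix, ← hd, mul_sub]
    simp
  have h2 : (fun k => ((lam k : ℂ) - z) * ((lam k : ℂ) - z)⁻¹) = fun _ => 1 :=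
    funext fun k => mul_inv_cancel₀ (sub_ne_zero.2 (hz k).symm)
  rw [← mul_assoc, ← mul_assoc, h1, mul_assoc (colMatrix e), Matrix.diagonal_mul_diagonal, h2,
    Matrix.diagonal_one, mul_one, h.mul_conjTranspose]

lemma sampleResolvent_apply (h : IsEigendecomposition A lam e) {z : ℂ} (hz : ∀ k, z ≠ lam k)
    (i j : Fin M) :
    sampleResolvent A z i j =
      ∑ k, ((lam k : ℂ) - z)⁻¹ * Matrix.vecMulVec (e k) (star (e k)) i j := by
  rw [h.sampleResolvent_eq hz, Matrix.mul_apply]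
  refine Finset.sum_congr rfl fun k _ => ?_
  rw [Matrix.mul_diagonal, Matrix.vecMulVec_apply]
  simp only [colMatrix, Matrix.of_apply, Matrix.conjTranspose_apply, Pi.star_apply]
  ring

lemma hasTraces (h : IsEigendecomposition A lam e) : HasTraces A lam where
  trace z hz := by
    rw [h.sampleResolvent_eq hz, Matrix.trace_mul_comm, ← mul_assoc, h.conjTranspose_mul, one_mul,
      Matrix.trace_diagonal]
  trace_mul z hz := by
    rw [h.sampleResolvent_eq hz, ← mul_assoc, ← mul_assoc, h.mul_colMatrix, mul_assoc (colMatrix e),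
      Matrix.diagonal_mul_diagonal, Matrix.trace_mul_comm, ← mul_assoc, h.conjTranspose_mul,
      one_mul, Matrix.trace_diagonal]

variable {A' : Matrix (Fin M) (Fin M) ℂ} {lam' : Fin M → ℝ} {e' : Fin M → Fin M → ℂ}

lemma trace_sampleResolvent_mul (h : IsEigendecomposition A lam e)
    (h' : IsEigendecomposition A' lam' e') {z z' : ℂ} (hz : ∀ k, z ≠ lam k)
    (hz' : ∀ k, z' ≠ lam' k) :
    (sampleResolvent A z * sampleResolvent A' z').trace =
      ∑ k, ∑ m, ((‖star (e k) ⬝ᵥ e' m‖ ^ 2 : ℝ) : ℂ) *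
        (((lam k : ℂ) - z)⁻¹ * ((lam' m : ℂ) - z')⁻¹) := by
  set D := Matrix.diagonal (fun k => ((lam k : ℂ) - z)⁻¹)
  set D' := Matrix.diagonal (fun k => ((lam' k : ℂ) - z')⁻¹)
  set W := (colMatrix e)ᴴ * colMatrix e' with hW
  have h1 : (sampleResolvent A z * sampleResolvent A' z').trace = (D * W * (D' * Wᴴ)).trace := by
    rw [h.sampleResolvent_eq hz, h'.sampleResolvent_eq hz', hW, Matrix.conjTranspose_mul,
      Matrix.conjTranspose_conjTranspose]
    simp only [mul_assoc]
    rw [Matrix.trace_mul_comm]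
    simp only [mul_assoc]
    rfl
  rw [h1, Matrix.trace]
  refine Finset.sum_congr rfl fun k _ => ?_
  rw [Matrix.diag_apply, Matrix.mul_apply]
  refine Finset.sum_congr rfl fun m _ => ?_
  rw [Matrix.diagonal_mul, Matrix.diagonal_mul, Matrix.conjTranspose_apply, hW,
    conjTranspose_colMatrix_mul_apply, Complex.ofReal_pow, ← Complex.mul_conj', starRingEnd_apply]
  ring

/-- Parseval: the overlap matrix of two orthonormal bases is unitary, so its squared moduli sum to 1
along each row. -/
lemma sum_norm_sq (h : IsEigendecomposition A lam e) (h' : IsEigendecomposition A' lam' e')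
    (k : Fin M) : ∑ m, ‖star (e k) ⬝ᵥ e' m‖ ^ 2 = 1 := by
  have h1 : ((colMatrix e)ᴴ * colMatrix e') * ((colMatrix e)ᴴ * colMatrix e')ᴴ = 1 := by
    rw [Matrix.conjTranspose_mul, Matrix.conjTranspose_conjTranspose, mul_assoc,
      ← mul_assoc (colMatrix e'), h'.mul_conjTranspose, one_mul, h.conjTranspose_mul]
  have h2 := congrFun (congrFun h1 k) k
  rw [Matrix.mul_apply, Matrix.one_apply_eq] at h2
  rw [← Complex.ofReal_inj, Complex.ofReal_sum, Complex.ofReal_one, ← h2]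
  refine Finset.sum_congr rfl fun m _ => ?_
  rw [Matrix.conjTranspose_apply, conjTranspose_colMatrix_mul_apply, Complex.ofReal_pow,
    ← Complex.mul_conj', starRingEnd_apply]

lemma sum_norm_sq' (h : IsEigendecomposition A lam e) (h' : IsEigendecomposition A' lam' e')
    (m : Fin M) : ∑ k, ‖star (e k) ⬝ᵥ e' m‖ ^ 2 = 1 := by
  rw [← h'.sum_norm_sq h m]
  refine Finset.sum_congr rfl fun k _ => ?_
  rw [Matrix.star_dotProduct, norm_star]

end IsEigendecomposition

end Eigenbasis

/-! ### Evaluation of the estimators -/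

section Estimators

variable {M N : ℕ} {A : Matrix (Fin M) (Fin M) ℂ} {lam mu : Fin M → ℝ} {e : Fin M → Fin M → ℂ}
  {γ : Contour} {f g : ℂ → ℂ}

/-- The integrand of `coeffIntegral`. -/
def coeffIntegrand (lam mu : Fin M → ℝ) (g : ℂ → ℂ) (k : Fin M) (z : ℂ) : ℂ :=
  g (logOmega lam mu z) * (z * logOmegaDeriv lam mu z) * (z - lam k)⁻¹

lemma residue_coeffIntegrand (k : Fin M) :
    γ.residue (coeffIntegrand lam mu g k) = coeffIntegral lam mu γ g k := rfl

lemma continuousOn_coeffIntegrand (hγ : γ.IsAdmissible lam mu) (h : Interlaced N lam mu)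
    (hg : Continuous g) (k : Fin M) : ContinuousOn (coeffIntegrand lam mu g k) γ.image :=
  ((hg.comp_continuousOn (hγ.continuousOn_logOmega h)).mul
    (continuousOn_id.mul (hγ.continuousOn_logOmegaDeriv h))).mul
      (hγ.encloses_lam h k).continuousOn_inv_sub

lemma hHat_mul_inv_sub (h : Interlaced N lam mu) (hA : HasTraces A lam)
    (hfg : ∀ w, f w = g (Complex.log w)) {z : ℂ} (hz : z ∈ cutPlane lam mu) (k : Fin M) :
    hHat N A f z * ((lam k : ℂ) - z)⁻¹ = -coeffIntegrand lam mu g k z := by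
  rw [h.hHat_eq hA hz, hfg, h.log_omegaHat hA hz, coeffIntegrand, ← neg_sub z (lam k : ℂ), inv_neg,
    mul_neg]

lemma Contour.inv_mul_integral (F : ℂ → ℂ) :
    (2 * (Real.pi : ℂ) * Complex.I)⁻¹ * γ.integral F = γ.residue fun z => -F z := by
  rw [Contour.residue_neg, Contour.residue, neg_neg]

lemma matrixEstimator_eq (hγ : γ.IsAdmissible lam mu) (h : Interlaced N lam mu)
    (hA : IsEigendecomposition A lam e) (hfg : ∀ w, f w = g (Complex.log w)) (hg : Continuous g) :
    matrixEstimator N A f γ =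
      ∑ k, coeffIntegral lam mu γ g k • Matrix.vecMulVec (e k) (star (e k)) := by
  ext i j
  have h1 : EqOn (fun z => -(hHat N A f z * sampleResolvent A z i j))
      (fun z => ∑ k, Matrix.vecMulVec (e k) (star (e k)) i j * coeffIntegrand lam mu g k z)
      γ.image := by
    intro z hz
    have hzc := hγ.image_subset_cutPlane hz
    simp only
    rw [hA.sampleResolvent_apply (fun k => sub_ne_zero.1 (h.sub_lam_ne_zero hzc k)),
      Finset.mul_sum, ← Finset.sum_neg_distrib]
    refine Finset.sum_congr rfl fun k _ => ?_
    rw [← mul_assoc, hHat_mul_inv_sub h hA.hasTraces hfg hzc]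
    ring
  rw [matrixEstimator, Matrix.of_apply, Contour.inv_mul_integral, Contour.residue_congr h1,
    Contour.residue_sum _ fun k _ =>
      continuousOn_const.fun_mul (continuousOn_coeffIntegrand hγ h hg k), Matrix.sum_apply]
  refine Finset.sum_congr rfl fun k _ => ?_
  rw [Contour.residue_const_mul, Matrix.smul_apply, smul_eq_mul, mul_comm]
  rfl

lemma alphaIntegral_eq (hγ : γ.IsAdmissible lam mu) (h : Interlaced N lam mu) (hM : 0 < M)
    (hA : HasTraces A lam) : alphaIntegral N A γ = (alphaClosed N lam mu : ℂ) := by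
  have hM0 : (M : ℂ) ≠ 0 := by exact_mod_cast hM.ne'
  have h1 : EqOn (fun z => -(Complex.log (omegaHat N A z) ^ 2 *
        (z * deriv (omegaHat N A) z / omegaHat N A z) *
        ((1 / (M : ℂ)) * (sampleResolvent A z).trace)))
      (fun z => (1 / (M : ℂ)) * ∑ k, coeffIntegrand lam mu (fun l => l ^ 2) k z) γ.image := by
    intro z hz
    have hzc := hγ.image_subset_cutPlane hz
    simp only
    rw [hA.trace z (fun k => sub_ne_zero.1 (h.sub_lam_ne_zero hzc k)), mul_left_comm,
      Finset.mul_sum, ← mul_neg, ← Finset.sum_neg_distrib]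
    congr 1
    refine Finset.sum_congr rfl fun k _ => ?_
    rw [← neg_eq_iff_eq_neg.2 (hHat_mul_inv_sub h hA (f := fun w => Complex.log w ^ 2)
      (fun _ => rfl) hzc k), hHat]
    ring
  have h2 := Contour.residue_sum (γ := γ) Finset.univ fun k _ =>
    continuousOn_coeffIntegrand hγ h (continuous_pow 2) k
  rw [alphaIntegral, Contour.inv_mul_integral, Contour.residue_congr h1, Contour.residue_const_mul,
    h2]
  simp only [residue_coeffIntegrand]
  rw [hγ.sum_coeffIntegral_sq h hM, Complex.ofReal_mul, Complex.ofReal_natCast]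
  field_simp

variable {N' : ℕ} {A' : Matrix (Fin M) (Fin M) ℂ} {lam' mu' : Fin M → ℝ}
  {e' : Fin M → Fin M → ℂ} {γ' : Contour} {f' g' : ℂ → ℂ}

/-- For fixed z₁ the trace is a finite sum of products of a function of z₁ and a function of z₂, so
linearity alone separates the iterated integral. -/
lemma double_integral_eq (hγ : γ.IsAdmissible lam mu) (h : Interlaced N lam mu)
    (hA : IsEigendecomposition A lam e) (hfg : ∀ w, f w = g (Complex.log w)) (hg : Continuous g)
    (hγ' : γ'.IsAdmissible lam' mu') (h' : Interlaced N' lam' mu')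
    (hA' : IsEigendecomposition A' lam' e') (hfg' : ∀ w, f' w = g' (Complex.log w))
    (hg' : Continuous g') :
    (-1 / (4 * (Real.pi : ℂ) ^ 2)) * γ.integral (fun z₁ => γ'.integral (fun z₂ =>
      hHat N A f z₁ * hHat N' A' f' z₂ *
        ((1 / (M : ℂ)) * (sampleResolvent A z₁ * sampleResolvent A' z₂).trace))) =
      (1 / (M : ℂ)) * ∑ k, ∑ m, ((‖star (e k) ⬝ᵥ e' m‖ ^ 2 : ℝ) : ℂ) *
        (coeffIntegral lam mu γ g k * coeffIntegral lam' mu' γ' g' m) := by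
  set w : Fin M → Fin M → ℂ := fun k m => ((‖star (e k) ⬝ᵥ e' m‖ ^ 2 : ℝ) : ℂ)
  have hc := continuousOn_coeffIntegrand hγ h hg
  have hc' := continuousOn_coeffIntegrand hγ' h' hg'
  -- The prefactor is (2πi)⁻²; the two minus signs belong to the clockwise normalization of the two
  -- residues.
  have hpi : (-1 / (4 * (Real.pi : ℂ) ^ 2)) =
      (-(2 * (Real.pi : ℂ) * Complex.I)⁻¹) * (-(2 * (Real.pi : ℂ) * Complex.I)⁻¹) := by
    have : (Real.pi : ℂ) ≠ 0 := by exact_mod_cast Real.pi_ne_zero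
    field_simp
    rw [Complex.I_sq]
    norm_num
  have inner : EqOn (fun z₁ => γ'.residue (fun z₂ => hHat N A f z₁ * hHat N' A' f' z₂ *
        ((1 / (M : ℂ)) * (sampleResolvent A z₁ * sampleResolvent A' z₂).trace)))
      (fun z₁ => ∑ k, (∑ m, (1 / (M : ℂ)) * w k m * coeffIntegral lam' mu' γ' g' m) *
        coeffIntegrand lam mu g k z₁) γ.image := by
    intro z₁ hz₁
    have hz₁c := hγ.image_subset_cutPlane hz₁
    have h1 : EqOn (fun z₂ => hHat N A f z₁ * hHat N' A' f' z₂ *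
          ((1 / (M : ℂ)) * (sampleResolvent A z₁ * sampleResolvent A' z₂).trace))
        (fun z₂ => ∑ k, ∑ m, (1 / (M : ℂ)) * w k m * coeffIntegrand lam mu g k z₁ *
          coeffIntegrand lam' mu' g' m z₂) γ'.image := by
      intro z₂ hz₂
      have hz₂c := hγ'.image_subset_cutPlane hz₂
      simp only
      rw [hA.trace_sampleResolvent_mul hA' (fun k => sub_ne_zero.1 (h.sub_lam_ne_zero hz₁c k))
        (fun k => sub_ne_zero.1 (h'.sub_lam_ne_zero hz₂c k)), Finset.mul_sum, Finset.mul_sum]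
      refine Finset.sum_congr rfl fun k _ => ?_
      rw [Finset.mul_sum, Finset.mul_sum]
      refine Finset.sum_congr rfl fun m _ => ?_
      rw [← neg_eq_iff_eq_neg.2 (hHat_mul_inv_sub h hA.hasTraces hfg hz₁c k),
        ← neg_eq_iff_eq_neg.2 (hHat_mul_inv_sub h' hA'.hasTraces hfg' hz₂c m)]
      ring
    have c1 : ∀ k, ∀ m ∈ Finset.univ, ContinuousOn (fun z₂ => (1 / (M : ℂ)) * w k m *
        coeffIntegrand lam mu g k z₁ * coeffIntegrand lam' mu' g' m z₂) γ'.image :=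
      fun k m _ => continuousOn_const.fun_mul (hc' m)
    simp only
    rw [Contour.residue_congr h1,
      Contour.residue_sum _ fun k _ => continuousOn_finsetSum _ (c1 k)]
    refine Finset.sum_congr rfl fun k _ => ?_
    rw [Contour.residue_sum _ (c1 k), Finset.sum_mul]
    refine Finset.sum_congr rfl fun m _ => ?_
    rw [Contour.residue_const_mul, residue_coeffIntegrand]
    ring
  have c2 : ∀ k ∈ Finset.univ, ContinuousOn (fun z₁ =>
      (∑ m, (1 / (M : ℂ)) * w k m * coeffIntegral lam' mu' γ' g' m) *
        coeffIntegrand lam mu g k z₁) γ.image := fun k _ => continuousOn_const.fun_mul (hc k)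
  have houter := Contour.residue_congr inner
  rw [Contour.residue_sum _ c2] at houter
  rw [hpi, mul_assoc, ← Contour.integral_const_mul, neg_mul, ← Contour.residue]
  simp only [neg_mul]
  refine houter.trans ?_
  rw [Finset.mul_sum]
  refine Finset.sum_congr rfl fun k _ => ?_
  rw [Contour.residue_const_mul, residue_coeffIntegrand, Finset.sum_mul, Finset.mul_sum]
  refine Finset.sum_congr rfl fun m _ => ?_
  ring

end Estimators

end

end LogEuclid

open LogEuclid
theorem mainTheorem3 (M : ℕ) (hM : 0 < M) (N : Fin 2 → ℕ) (hN : ∀ j, M < N j)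
    (Y : (j : Fin 2) → Matrix (Fin M) (Fin (N j)) ℂ)
    (lam : Fin 2 → Fin M → ℝ) (e : Fin 2 → Fin M → Fin M → ℂ)
    (heig : ∀ j, IsEigendecomposition (sampleCov (Y j)) (lam j) (e j))
    (hpos : ∀ j k, 0 < lam j k) (hlam : ∀ j, StrictMono (lam j)) :
    -- the equation for the roots has exactly `M` solutions
    (∀ j, ∃! mu : Fin M → ℝ, IsRootList (N j) (lam j) mu) ∧
    ∀ mu : Fin 2 → Fin M → ℝ, (∀ j, IsRootList (N j) (lam j) (mu j)) →
      -- the integral for `log²`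
      (∀ j, ∀ γ : Contour, γ.IsAdmissible (lam j) (mu j) →
        alphaIntegral (N j) (sampleCov (Y j)) γ = (alphaClosed (N j) (lam j) (mu j) : ℂ)) ∧
      -- the integral for `log`
      (∀ j, ∀ γ : Contour, γ.IsAdmissible (lam j) (mu j) →
        matrixEstimator (N j) (sampleCov (Y j)) Complex.log γ =
          ∑ k, (betaCoeff (lam j) (mu j) k : ℂ) • Matrix.vecMulVec (e j k) (star (e j k))) ∧
      -- the estimator of the log-Euclidean distance
      (∀ C : Fin 2 → Fin 3 → Contour, (∀ j l, (C j l).IsAdmissible (lam j) (mu j)) →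
        distanceEstimator N (fun j => sampleCov (Y j)) logEuclidFun C =
          ((alphaClosed (N 0) (lam 0) (mu 0) + alphaClosed (N 1) (lam 1) (mu 1)
            - (2 / (M : ℝ)) * ∑ k, ∑ m, betaCoeff (lam 0) (mu 0) k * betaCoeff (lam 1) (mu 1) m *
                ‖star (e 0 k) ⬝ᵥ e 1 m‖ ^ 2 : ℝ) : ℂ)) := by
  refine ⟨fun j => ?_, fun mu hmu => ?_⟩
  · obtain ⟨mu, h⟩ := exists_interlaced (hN j) (hpos j) (hlam j)
    exact ⟨mu, h.isRootList, fun mu' h' => h'.unique h.isRootList⟩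
  have hI : ∀ j, Interlaced (N j) (lam j) (mu j) := fun j =>
    (hmu j).interlaced (hN j) (hpos j) (hlam j)
  refine ⟨fun j γ hγ => alphaIntegral_eq hγ (hI j) hM (heig j).hasTraces, fun j γ hγ => ?_,
    fun C hC => ?_⟩
  · rw [matrixEstimator_eq hγ (hI j) (heig j) (g := fun l => l) (fun _ => rfl) continuous_id]
    exact Finset.sum_congr rfl fun k _ => by rw [hγ.coeffIntegral_id (hI j)]
  · have hM0 : (M : ℂ) ≠ 0 := by exact_mod_cast hM.ne'
    have key := fun (l : Fin 3) (g g' : ℂ → ℂ) (hfg : ∀ w, logEuclidFun 0 l w = g (Complex.log w))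
        (hg : Continuous g) (hfg' : ∀ w, logEuclidFun 1 l w = g' (Complex.log w))
        (hg' : Continuous g') =>
      double_integral_eq (hC 0 l) (hI 0) (heig 0) hfg hg (hC 1 l) (hI 1) (heig 1) hfg' hg'
    have hs := (heig 0).sum_norm_sq (heig 1)
    have hs' := (heig 0).sum_norm_sq' (heig 1)
    rw [distanceEstimator, Fin.sum_univ_three,
      key 0 (fun l => l ^ 2) (fun _ => 1) (fun _ => rfl) (continuous_pow 2) (fun _ => rfl)
        continuous_const,
      key 1 (fun _ => 1) (fun l => l ^ 2) (fun _ => rfl) continuous_const (fun _ => rfl)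
        (continuous_pow 2),
      key 2 (fun l => -2 * l) (fun l => l) (fun _ => rfl) (continuous_const.mul continuous_id)
        (fun _ => rfl) continuous_id]
    -- The coefficients of the function 1 all equal 1, so the sum over m meets only the weights and
    -- gives 1.
    have e0 : ∑ k, ∑ m, ((‖star (e 0 k) ⬝ᵥ e 1 m‖ ^ 2 : ℝ) : ℂ) *
        (coeffIntegral (lam 0) (mu 0) (C 0 0) (fun l => l ^ 2) k *
          coeffIntegral (lam 1) (mu 1) (C 1 0) (fun _ => 1) m) =
        ((M * alphaClosed (N 0) (lam 0) (mu 0) : ℝ) : ℂ) := by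
      rw [← (hC 0 0).sum_coeffIntegral_sq (hI 0) hM]
      refine Finset.sum_congr rfl fun k _ => ?_
      simp only [(hC 1 0).coeffIntegral_one (hI 1), mul_one]
      rw [← Finset.sum_mul, ← Complex.ofReal_sum, hs, Complex.ofReal_one, one_mul]
    have e1 : ∑ k, ∑ m, ((‖star (e 0 k) ⬝ᵥ e 1 m‖ ^ 2 : ℝ) : ℂ) *
        (coeffIntegral (lam 0) (mu 0) (C 0 1) (fun _ => 1) k *
          coeffIntegral (lam 1) (mu 1) (C 1 1) (fun l => l ^ 2) m) =
        ((M * alphaClosed (N 1) (lam 1) (mu 1) : ℝ) : ℂ) := by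
      rw [← (hC 1 1).sum_coeffIntegral_sq (hI 1) hM, Finset.sum_comm]
      refine Finset.sum_congr rfl fun m _ => ?_
      simp only [(hC 0 1).coeffIntegral_one (hI 0), one_mul]
      rw [← Finset.sum_mul, ← Complex.ofReal_sum, hs', Complex.ofReal_one, one_mul]
    have e2 : ∀ k, coeffIntegral (lam 0) (mu 0) (C 0 2) (fun l => -2 * l) k =
        -2 * (betaCoeff (lam 0) (mu 0) k : ℂ) := fun k => by
      rw [← (hC 0 2).coeffIntegral_id (hI 0), coeffIntegral, coeffIntegral,
        ← Contour.residue_const_mul]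
      exact Contour.residue_congr fun z _ => by ring
    rw [e0, e1]
    simp only [e2, (hC 1 2).coeffIntegral_id (hI 1)]
    push_cast
    have e3 : ∀ k m, (‖star (e 0 k) ⬝ᵥ e 1 m‖ : ℂ) ^ 2 *
        (-2 * (betaCoeff (lam 0) (mu 0) k : ℂ) * (betaCoeff (lam 1) (mu 1) m : ℂ)) =
        -2 * ((betaCoeff (lam 0) (mu 0) k : ℂ) * (betaCoeff (lam 1) (mu 1) m : ℂ) *
          (‖star (e 0 k) ⬝ᵥ e 1 m‖ : ℂ) ^ 2) := fun k m => by ring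
    simp only [e3, ← Finset.mul_sum]
    field_simp
    ring
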